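/- Let $n \ge 2$ and let $M = (\mathbb{R}_+^*)^n = \{x \in \mathbb{R}^n : x_1,\dots,x_n > 0\}$. Let $f$ be a real function on $(0,\infty)$ such that the derivatives below exist on $(0,\infty)$ and $$f(x) = O(x^2) \text{ as } x \to 0^+,\quad f'(x) = O(x) \text{ as } x \to 0^+,\quad f(x) = O(x^2) \text{ as } x \to \infty,$$ $$f''(x) > 0 \quad\text{and}\quad \frac{d^2}{dx^2}\left(\frac{f(x)}{f'(x)}\right) > 0 \quad\text{for all } x > 0.$$ Then $$ds^2 = \frac{dx_1^2}{f(x_1)} + \cdots + \frac{dx_n^2}{f(x_n)} - \frac{(dx_1 + \cdots + dx_n)^2}{f(x_1 + \cdots + x_n)}$$ is a ($C^2$, positive-definite) Riemannian metric on $M$, and all its sectional curvatures are strictly negative: $K_x(u,v) < 0$ for every $x \in M$ and all linearly independent tangent vectors $u, v \in T_xM$. In particular, this holds for the family of Dirichlet distributions on the simplex $\{q \in \mathbb{R}^n : q_i \ge 0,\ \sum_i q_i = 1\}$, with densities with respect to Lebesgue measure (in the coordinates $q_1, \dots, q_{n-1}$) $$f_n(q \mid x) = \frac{\Gamma(x_1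 + \cdots + x_n)}{\Gamma(x_1)\cdots\Gamma(x_n)}\, q_1^{x_1 - 1} \cdots q_n^{x_n - 1}, \qquad x \in M .$$ Namely, its Fisher–Rao metric $g_{ij}(x) = -\mathbb{E}\left[\frac{\partial^2}{\partial x_i \partial x_j} \log f_n(Q \mid x)\right]$, where $Q$ has density $f_n(\cdot \mid x)$, is on $M$ the metric $ds^2$ above with $f = 1/\psi'$, where $\psi(x) = \frac{d}{dx}\log\Gamma(x)$; it is a ($C^2$, positive-definite) Riemannian metric on $M$, and all its sectional curvatures are strictly negative. -/

import Mathlib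

open Set Filter Topology MeasureTheory Asymptotics

namespace DirichletGeometry

/-! ### Riemannian metrics on open subsets of `ℝⁿ`, in the standard coordinates -/

/-- The partial derivative `∂F/∂xᵢ` at `x`. -/
noncomputable def partialDeriv {n : ℕ} (i : Fin n) (F : (Fin n → ℝ) → ℝ) (x : Fin n → ℝ) : ℝ :=
  fderiv ℝ F x (Pi.single i 1)

/-- `g` is the coordinate matrix of a Riemannian metric on the open set `U` of `ℝⁿ`, of class `C²`
(the regularity needed for its curvature tensor). -/
structure IsRiemannianMetricOn {n : ℕ} (g : (Fin n → ℝ) → Matrix (Fin n) (Fin n) ℝ)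
    (U : Set (Fin n → ℝ)) : Prop where
  isOpen : IsOpen U
  contDiffOn : ∀ i j, ContDiffOn ℝ 2 (fun x => g x i j) U
  posDef : ∀ x ∈ U, (g x).PosDef

/-- The Christoffel symbol `Γᵏᵢⱼ = ½ ∑ₗ gᵏˡ (∂ᵢ gⱼₗ + ∂ⱼ gᵢₗ - ∂ₗ gᵢⱼ)` of the Levi-Civita
connection of `g`. -/
noncomputable def christoffel {n : ℕ} (g : (Fin n → ℝ) → Matrix (Fin n) (Fin n) ℝ)
    (k i j : Fin n) (x : Fin n → ℝ) : ℝ :=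
  (1 / 2) * ∑ l, (g x)⁻¹ k l *
    (partialDeriv i (fun z => g z j l) x + partialDeriv j (fun z => g z i l) x
      - partialDeriv l (fun z => g z i j) x)

/-- The components of the Riemann curvature tensor: `R(∂ᵢ, ∂ⱼ) ∂ₖ = ∑ₗ (curvature g l i j k) ∂ₗ`,
where `R(X, Y) Z = ∇_X ∇_Y Z - ∇_Y ∇_X Z - ∇_{[X, Y]} Z`. -/
noncomputable def curvature {n : ℕ} (g : (Fin n → ℝ) → Matrix (Fin n) (Fin n) ℝ)
    (l i j k : Fin n) (x : Fin n → ℝ) : ℝ :=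
  partialDeriv i (christoffel g l j k) x - partialDeriv j (christoffel g l i k) x
    + ∑ m, (christoffel g m j k x * christoffel g l i m x
        - christoffel g m i k x * christoffel g l j m x)

/-- The inner product `⟨u, v⟩` of two tangent vectors at `x`. -/
noncomputable def metricInner {n : ℕ} (g : (Fin n → ℝ) → Matrix (Fin n) (Fin n) ℝ)
    (x u v : Fin n → ℝ) : ℝ :=
  ∑ i, ∑ j, g x i j * u i * v j

/-- The tangent vector `R(u, v) w` at `x`. -/
noncomputable def curvatureVector {n : ℕ} (g : (Fin n → ℝ) → Matrix (Fin n) (Fin n) ℝ)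
    (x u v w : Fin n → ℝ) : Fin n → ℝ :=
  fun l => ∑ i, ∑ j, ∑ k, curvature g l i j k x * u i * v j * w k

/-- The sectional curvature at `x` of the plane spanned by the linearly independent tangent
vectors `u` and `v`:
`K(u, v) = ⟨R(u, v) v, u⟩ / (⟨u, u⟩ ⟨v, v⟩ - ⟨u, v⟩²)`. -/
noncomputable def sectionalCurvature {n : ℕ} (g : (Fin n → ℝ) → Matrix (Fin n) (Fin n) ℝ)
    (x u v : Fin n → ℝ) : ℝ :=
  metricInner g x (curvatureVector g x u v v) u /
    (metricInner g x u u * metricInner g x v v - metricInner g x u v ^ 2)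

/-- All sectional curvatures of `g` are strictly negative at every point of `U`. -/
def HasNegativeSectionalCurvatureOn {n : ℕ} (g : (Fin n → ℝ) → Matrix (Fin n) (Fin n) ℝ)
    (U : Set (Fin n → ℝ)) : Prop :=
  ∀ x ∈ U, ∀ u v : Fin n → ℝ, LinearIndependent ℝ ![u, v] → sectionalCurvature g x u v < 0

/-! ### The metrics of the family -/

/-- The open orthant `M = (ℝ₊*)ⁿ`. -/
def orthant (n : ℕ) : Set (Fin n → ℝ) := {x | ∀ i, 0 < x i}

/-- The metric `ds² = ∑ᵢ dxᵢ² / f(xᵢ) - (∑ᵢ dxᵢ)² / f(∑ᵢ xᵢ)`. -/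
noncomputable def profileMetric (f : ℝ → ℝ) {n : ℕ} (x : Fin n → ℝ) :
    Matrix (Fin n) (Fin n) ℝ :=
  Matrix.of fun i j => (if i = j then 1 / f (x i) else 0) - 1 / f (∑ l, x l)

/-- The standing assumptions on `f`. Only the values of `f` on `(0, ∞)` matter. The first four
fields say that the derivatives occurring in the others exist. -/
structure IsAdmissibleProfile (f : ℝ → ℝ) : Prop where
  differentiableOn : DifferentiableOn ℝ f (Ioi 0)
  differentiableOn_deriv : DifferentiableOn ℝ (deriv f) (Ioi 0)
  differentiableOn_quot : DifferentiableOn ℝ (fun x => f x / deriv f x) (Ioi 0)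
  differentiableOn_deriv_quot : DifferentiableOn ℝ (deriv fun x => f x / deriv f x) (Ioi 0)
  isBigO_zero : f =O[𝓝[>] 0] fun x => x ^ 2
  deriv_isBigO_zero : deriv f =O[𝓝[>] 0] fun x => x
  isBigO_atTop : f =O[atTop] fun x => x ^ 2
  deriv_deriv_pos : ∀ x > 0, 0 < deriv (deriv f) x
  deriv_deriv_quot_pos : ∀ x > 0, 0 < deriv (deriv fun y => f y / deriv f y) x

/-! ### The Fisher–Rao metric of the Dirichlet distributions -/

/-- The digamma function `ψ = (log Γ)'`. -/
noncomputable def digamma (x : ℝ) : ℝ := deriv (fun y => Real.log (Real.Gamma y)) x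

/-- The trigamma function `ψ'`. -/
noncomputable def trigamma (x : ℝ) : ℝ := deriv digamma x

/-- Lebesgue measure on the probability simplex `{q ∈ ℝⁿ | qᵢ ≥ 0, ∑ᵢ qᵢ = 1}`, i.e. the image of
Lebesgue measure under the parametrization of the simplex by its first `n - 1` coordinates
(for `n = 0` the simplex is empty). -/
noncomputable def simplexLebesgue : (n : ℕ) → Measure (Fin n → ℝ)
  | 0 => 0
  | m + 1 =>
    ((volume : Measure (Fin m → ℝ)).restrict {y | (∀ i, 0 ≤ y i) ∧ ∑ i, y i ≤ 1}).map
      fun y => Fin.snoc (α := fun _ => ℝ) y (1 - ∑ i, y i)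

/-- The Dirichlet density
`fₙ(q | x) = Γ(x₁ + ⋯ + xₙ) / (Γ(x₁) ⋯ Γ(xₙ)) * q₁ ^ (x₁ - 1) ⋯ qₙ ^ (xₙ - 1)`. -/
noncomputable def dirichletDensity {n : ℕ} (x q : Fin n → ℝ) : ℝ :=
  Real.Gamma (∑ i, x i) / (∏ i, Real.Gamma (x i)) * ∏ i, q i ^ (x i - 1)

/-- The Dirichlet distribution with parameters `x₁, …, xₙ > 0`. -/
noncomputable def dirichletMeasure {n : ℕ} (x : Fin n → ℝ) : Measure (Fin n → ℝ) :=
  (simplexLebesgue n).withDensity fun q => ENNReal.ofReal (dirichletDensity x q)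

/-- The Fisher–Rao metric of the Dirichlet distributions, given by the Fisher information matrix
`gᵢⱼ(x) = -𝔼[∂ᵢ ∂ⱼ log fₙ(Q | x)]`, where `Q` has the Dirichlet distribution of parameter `x`. -/
noncomputable def dirichletFisherRao {n : ℕ} (x : Fin n → ℝ) : Matrix (Fin n) (Fin n) ℝ :=
  Matrix.of fun i j =>
    -∫ q, partialDeriv i (partialDeriv j fun z => Real.log (dirichletDensity z q)) x
      ∂dirichletMeasure x

end DirichletGeometry

namespace DirichletGeometry

/-! Put `s = ∑ xᵢ`, `yᵢ = ∫ dxᵢ / √f(xᵢ)`, `y₀ = ∫ ds / √f(s)`. Then `ds² = ∑ dyᵢ² - dy₀²`: the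
orthant is a hypersurface of Minkowski space. It is spacelike when `∑ f(xᵢ) < f(s)`, by a strict
Cauchy–Schwarz inequality. The ambient space is flat and the normal timelike, so the Gauss equation
makes the numerator of the sectional curvature a negative multiple of `B(u,u) B(v,v) - B(u,v)²`,
with `B` proportional to the second fundamental form. Here `B = diag (f'/f (xᵢ)) - f'/f (s)` has the
same form as the metric, with `f / f'` in place of `f`. Negative curvature thus follows from strict
superadditivity of `f` and of `f / f'`. The embedding only guides the proof:
`curvature_profileMetric` verifies the Gauss equation in coordinates.

A function `F` is strictly superadditive once `F t / t` strictly increases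
(`sum_lt_of_strictMonoOn_div`), so everything is reduced to `IsStarShapedProfile`. An admissible `f`
qualifies because `f` and `f / f'` are strictly convex with limit `0` at `0`.

For the Dirichlet family, write `S_p(x) = ∑ₖ (x + k)⁻ᵖ`, so that `ψ' = S₂`. The Hessian of the
log-density does not depend on `q`, so its expectation is immediate once the total mass is known to
be `1`. With `f = 1 / S₂`, star-shapedness means that `x S₂` and `x S₃ / S₂` strictly decrease. The
first follows by comparing unit steps; the second is the Chebyshev-type inequality
`hurwitzSum_mul_lt`. -/

/-! ### Superadditivity and the quadratic forms `diag (1 / cᵢ) - 1 / C`. -/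

theorem sum_lt_of_strictMonoOn_div {n : ℕ} (hn : 2 ≤ n) {F : ℝ → ℝ}
    (hF : StrictMonoOn (fun t => F t / t) (Ioi 0)) {x : Fin n → ℝ} (hx : x ∈ orthant n) :
    ∑ i, F (x i) < F (∑ i, x i) := by
  have : Nonempty (Fin n) := ⟨⟨0, by omega⟩⟩
  have hs : 0 < ∑ i, x i := Finset.sum_pos (fun i _ => hx i) Finset.univ_nonempty
  have hlt : ∀ i, x i < ∑ l, x l := by
    intro i
    have : Nontrivial (Fin n) := Fin.nontrivial_iff_two_le.2 hn
    obtain ⟨j, hj⟩ := exists_ne i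
    exact Finset.single_lt_sum hj (Finset.mem_univ i) (Finset.mem_univ j) (hx j)
      (fun k _ _ => (hx k).le)
  -- Each ratio `F (x i) / x i` is strictly below the ratio at the sum, since `2 ≤ n` makes every
  -- coordinate smaller than the sum.
  calc ∑ i, F (x i) = ∑ i, x i * (F (x i) / x i) :=
        Finset.sum_congr rfl fun i _ => (mul_div_cancel₀ _ (hx i).ne').symm
    _ < ∑ i, x i * (F (∑ l, x l) / ∑ l, x l) :=
        Finset.sum_lt_sum_of_nonempty Finset.univ_nonempty fun i _ =>
          mul_lt_mul_of_pos_left (hF (hx i) hs (hlt i)) (hx i)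
    _ = F (∑ i, x i) := by rw [← Finset.sum_mul, mul_div_cancel₀ _ hs.ne']

/-- A strict form of the Cauchy–Schwarz (Sedrakyan) inequality. -/
theorem sq_sum_div_lt_sum_sq_div {n : ℕ} {c : Fin n → ℝ} {C : ℝ} (hc : ∀ i, 0 < c i)
    (hC : ∑ i, c i < C) {u : Fin n → ℝ} (hu : u ≠ 0) :
    (∑ i, u i) ^ 2 / C < ∑ i, u i ^ 2 / c i := by
  obtain ⟨k, hk⟩ := Function.ne_iff.1 hu
  have hk : u k ≠ 0 := hk
  have hpos : 0 < ∑ i, c i := Finset.sum_pos (fun i _ => hc i) ⟨k, Finset.mem_univ k⟩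
  rcases eq_or_ne (∑ i, u i) 0 with h | h
  · rw [h]
    simp only [ne_eq, OfNat.ofNat_ne_zero, not_false_eq_true, zero_pow, zero_div]
    exact Finset.sum_pos' (fun i _ => div_nonneg (sq_nonneg _) (hc i).le)
      ⟨k, Finset.mem_univ k, div_pos (by positivity) (hc k)⟩
  · exact (div_lt_div_of_pos_left (by positivity) hpos hC).trans_le
      (Finset.sq_sum_div_le_sum_sq_div _ _ fun i _ => hc i)

/-- The bilinear form with matrix `diag (1 / cᵢ) - 1 / C`. -/
theorem sum_diag_sub_const {n : ℕ} (c : Fin n → ℝ) (C : ℝ) (u v : Fin n → ℝ) :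
    ∑ i, ∑ j, ((if i = j then 1 / c i else 0) - 1 / C) * u i * v j =
      ∑ i, u i * v i / c i - (∑ i, u i) * (∑ i, v i) / C := by
  simp_rw [sub_mul, Finset.sum_sub_distrib, ite_mul, zero_mul, Finset.sum_ite_eq, Finset.mem_univ,
    if_true]
  congr 1
  · exact Finset.sum_congr rfl fun i _ => by ring
  · rw [Finset.sum_mul_sum, Finset.sum_div]
    refine Finset.sum_congr rfl fun i _ => ?_
    rw [Finset.sum_div]
    exact Finset.sum_congr rfl fun j _ => by ring

/-! ### Star-shaped profiles and positivity of the metric. -/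

/-- The assumptions on `f` that make `profileMetric f` positive definite and negatively curved:
`f` and `f / f'` are star-shaped, hence strictly superadditive. -/
structure IsStarShapedProfile (f : ℝ → ℝ) : Prop where
  contDiffOn : ContDiffOn ℝ 2 f (Ioi 0)
  pos : ∀ x > 0, 0 < f x
  deriv_pos : ∀ x > 0, 0 < deriv f x
  strictMonoOn_div : StrictMonoOn (fun x => f x / x) (Ioi 0)
  strictMonoOn_quot_div : StrictMonoOn (fun x => f x / deriv f x / x) (Ioi 0)

theorem isOpen_orthant (n : ℕ) : IsOpen (orthant n) := by
  have : orthant n = Set.univ.pi fun _ => Ioi 0 := by ext; simp [orthant]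
  rw [this]
  exact isOpen_set_pi Set.finite_univ fun _ _ => isOpen_Ioi

theorem sum_pos_of_mem_orthant {n : ℕ} (hn : 0 < n) {x : Fin n → ℝ} (hx : x ∈ orthant n) :
    0 < ∑ i, x i :=
  Finset.sum_pos (fun i _ => hx i) ⟨⟨0, hn⟩, Finset.mem_univ _⟩

theorem IsStarShapedProfile.isRiemannianMetricOn {f : ℝ → ℝ} (hf : IsStarShapedProfile f) {n : ℕ}
    (hn : 2 ≤ n) : IsRiemannianMetricOn (profileMetric f) (orthant n) where
  isOpen := isOpen_orthant n
  contDiffOn i j := by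
    have h1 : ContDiffOn ℝ 2 (fun t => 1 / f t) (Ioi 0) :=
      contDiffOn_const.div hf.contDiffOn fun t ht => (hf.pos t ht).ne'
    have h2 : ContDiffOn ℝ 2 (fun x : Fin n → ℝ => 1 / f (∑ l, x l)) (orthant n) :=
      h1.comp (g := fun t => 1 / f t) (f := fun x : Fin n → ℝ => ∑ l, x l)
        (ContDiff.contDiffOn (by fun_prop))
        fun x hx => sum_pos_of_mem_orthant (by omega) hx
    simp only [profileMetric, Matrix.of_apply]
    refine ContDiffOn.sub ?_ h2
    split_ifs
    · exact h1.comp (g := fun t => 1 / f t) (f := fun x : Fin n → ℝ => x i)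
        (ContDiff.contDiffOn (by fun_prop)) fun x hx => hx i
    · exact contDiffOn_const
  posDef x hx := by
    refine Matrix.PosDef.of_dotProduct_mulVec_pos ?_ ?_
    · ext i j
      simp only [profileMetric, Matrix.conjTranspose_apply, Matrix.of_apply, star_trivial]
      by_cases h : i = j
      · subst h; simp
      · rw [if_neg h, if_neg (Ne.symm h)]
    · intro u hu
      have key := sq_sum_div_lt_sum_sq_div (c := fun i => f (x i)) (fun i => hf.pos _ (hx i))
        (sum_lt_of_strictMonoOn_div hn hf.strictMonoOn_div hx) hu
      have := sum_diag_sub_const (fun i => f (x i)) (f (∑ i, x i)) u u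
      have h2 : star u ⬝ᵥ (profileMetric f x).mulVec u =
          ∑ i, ∑ j, ((if i = j then 1 / f (x i) else 0) - 1 / f (∑ l, x l)) * u i * u j := by
        simp only [dotProduct, Matrix.mulVec, profileMetric, Matrix.of_apply, star_trivial,
          Finset.mul_sum]
        exact Finset.sum_congr rfl fun i _ => Finset.sum_congr rfl fun j _ => by ring
      rw [h2, this, sub_pos, ← sq]
      simpa only [sq] using key

/-! ### Christoffel symbols and curvature tensor in coordinates. -/

theorem partialDeriv_of_hasFDerivAt {n : ℕ} {F : (Fin n → ℝ) → ℝ} {F' : (Fin n → ℝ) →L[ℝ] ℝ}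
    {x : Fin n → ℝ} (h : HasFDerivAt F F' x) (i : Fin n) :
    partialDeriv i F x = F' (Pi.single i 1) := by
  rw [DirichletGeometry.partialDeriv, h.fderiv]

theorem partialDeriv_congr {n : ℕ} {F G : (Fin n → ℝ) → ℝ} {x : Fin n → ℝ} (h : F =ᶠ[𝓝 x] G)
    (i : Fin n) : partialDeriv i F x = partialDeriv i G x := by
  rw [partialDeriv, partialDeriv, h.fderiv_eq]

theorem hasFDerivAt_comp_coord {n : ℕ} {φ : ℝ → ℝ} {φ' : ℝ} {x : Fin n → ℝ} (i : Fin n)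
    (h : HasDerivAt φ φ' (x i)) :
    HasFDerivAt (fun z : Fin n → ℝ => φ (z i))
      (φ' • (ContinuousLinearMap.proj i : (Fin n → ℝ) →L[ℝ] ℝ)) x :=
  h.comp_hasFDerivAt x (hasFDerivAt_apply i x)

theorem hasFDerivAt_comp_sum {n : ℕ} {φ : ℝ → ℝ} {φ' : ℝ} {x : Fin n → ℝ}
    (h : HasDerivAt φ φ' (∑ i, x i)) :
    HasFDerivAt (fun z : Fin n → ℝ => φ (∑ i, z i))
      (φ' • ∑ i, (ContinuousLinearMap.proj i : (Fin n → ℝ) →L[ℝ] ℝ)) x :=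
  h.comp_hasFDerivAt (f := fun z : Fin n → ℝ => ∑ i, z i) x
    (HasFDerivAt.fun_sum fun i _ => hasFDerivAt_apply i x)

theorem sum_proj_single {n : ℕ} (i : Fin n) :
    (∑ l, (ContinuousLinearMap.proj l : (Fin n → ℝ) →L[ℝ] ℝ)) (Pi.single i 1) = 1 := by
  simp

theorem partialDeriv_profileMetric {f : ℝ → ℝ} {n : ℕ} {x : Fin n → ℝ} (i j l : Fin n) {a A : ℝ}
    (ha : HasDerivAt (fun t => 1 / f t) a (x i))
    (hA : HasDerivAt (fun t => 1 / f t) A (∑ i, x i)) :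
    partialDeriv l (fun z => profileMetric f z i j) x =
      (if i = j then if l = i then a else 0 else 0) - A := by
  have h2 := hasFDerivAt_comp_sum hA
  by_cases h : i = j
  · subst h
    have := partialDeriv_of_hasFDerivAt ((hasFDerivAt_comp_coord i ha).sub h2) l
    simp only [profileMetric, Matrix.of_apply, if_true]
    refine this.trans ?_
    rw [sub_apply, smul_apply,
      smul_apply, sum_proj_single]
    simp [Pi.single_apply, eq_comm]
  · have := partialDeriv_of_hasFDerivAt ((hasFDerivAt_const (0 : ℝ) x).sub h2) l
    simp only [profileMetric, Matrix.of_apply, if_neg h]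
    refine this.trans ?_
    rw [sub_apply, smul_apply, sum_proj_single]
    simp

/-- `f (∑ᵢ xᵢ) - ∑ᵢ f (xᵢ)`. -/
noncomputable def profileGap (f : ℝ → ℝ) {n : ℕ} (x : Fin n → ℝ) : ℝ :=
  f (∑ i, x i) - ∑ i, f (x i)

/-- A multiple of the second fundamental form of the orthant, with metric `profileMetric f`,
as a spacelike hypersurface of Minkowski space. -/
noncomputable def profileSecondForm (f : ℝ → ℝ) {n : ℕ} (i j : Fin n) (x : Fin n → ℝ) : ℝ :=
  (if i = j then deriv f (x i) / f (x i) else 0) - deriv f (∑ l, x l) / f (∑ l, x l)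

theorem profileSecondForm_comm (f : ℝ → ℝ) {n : ℕ} (i j : Fin n) (x : Fin n → ℝ) :
    profileSecondForm f i j x = profileSecondForm f j i x := by
  by_cases h : i = j
  · rw [h]
  · simp [profileSecondForm, h, Ne.symm h]

section

variable {f : ℝ → ℝ} {n : ℕ} {x : Fin n → ℝ}

/-- Sherman–Morrison formula for a rank-one perturbation of a diagonal matrix. -/
theorem profileMetric_inv (hpos : ∀ i, f (x i) ≠ 0) (hs : f (∑ i, x i) ≠ 0)
    (hgap : profileGap f x ≠ 0) :
    (profileMetric f x)⁻¹ = Matrix.of fun k l =>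
      (if k = l then f (x k) else 0) + f (x k) * f (x l) / profileGap f x := by
  refine Matrix.inv_eq_right_inv ?_
  ext i j
  have hsum : ∑ k, f (x k) = f (∑ i, x i) - profileGap f x := by rw [profileGap]; ring
  have h1 : ∑ k, f (x k) * f (x j) / profileGap f x =
      (f (∑ i, x i) - profileGap f x) * f (x j) / profileGap f x := by
    rw [← hsum, Finset.sum_mul, Finset.sum_div]
  simp only [Matrix.mul_apply, profileMetric, Matrix.of_apply, sub_mul, ite_mul, zero_mul,
    Finset.sum_sub_distrib, Finset.sum_ite_eq, Finset.mem_univ, if_true, ← Finset.mul_sum,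
    Finset.sum_add_distrib, h1, Finset.sum_ite_eq', Matrix.one_apply]
  have := hpos i
  split_ifs with h
  · subst h
    field_simp
    ring
  · field_simp
    ring

theorem hasDerivAt_one_div_profile {t : ℝ} (h : f t ≠ 0) (hd : DifferentiableAt ℝ f t) :
    HasDerivAt (fun t => 1 / f t) (-(deriv f t / f t) / f t) t := by
  have := hd.hasDerivAt.inv h
  simp only [one_div]
  refine this.congr_deriv ?_
  field_simp

/-- The first summand is the connection of the diagonal metric `∑ dxᵢ² / f(xᵢ)`; the rank-one term
adds `Nᵏ Bᵢⱼ` with `Nᵏ = -f(xₖ) / (2Δ)`, `Δ` the gap. Only a germ equality is assumed of `g`, so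
that the Fisher–Rao metric, known on the orthant alone, is covered. -/
theorem christoffel_profileMetric {g : (Fin n → ℝ) → Matrix (Fin n) (Fin n) ℝ}
    (hg : g =ᶠ[𝓝 x] profileMetric f)
    (hpos : ∀ i, f (x i) ≠ 0) (hs : f (∑ i, x i) ≠ 0) (hgap : profileGap f x ≠ 0)
    (hd : ∀ i, DifferentiableAt ℝ f (x i)) (hds : DifferentiableAt ℝ f (∑ i, x i))
    (k i j : Fin n) :
    christoffel g k i j x =
      -(1 / 2) * (if i = j then if k = i then deriv f (x i) / f (x i) else 0 else 0) +
        -(1 / 2) * f (x k) / profileGap f x * profileSecondForm f i j x := by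
  have hA := hasDerivAt_one_div_profile hs hds
  have hp : ∀ i j l, partialDeriv l (fun z => g z i j) x =
      (if i = j then if l = i then (-(deriv f (x i) / f (x i)) / f (x i)) else 0 else 0)
        - (-(deriv f (∑ i, x i) / f (∑ i, x i)) / f (∑ i, x i)) := by
    intro i j l
    rw [← partialDeriv_profileMetric i j l (hasDerivAt_one_div_profile (hpos i) (hd i)) hA]
    exact partialDeriv_congr (hg.mono fun z hz => by simp only [hz]) l
  have hlow : ∀ l, partialDeriv i (fun z => g z j l) x + partialDeriv j (fun z => g z i l) x
      - partialDeriv l (fun z => g z i j) x =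
      (if l = i then if i = j then -(deriv f (x i) / f (x i)) / f (x i) else 0 else 0)
        + (deriv f (∑ i, x i) / f (∑ i, x i)) / f (∑ i, x i) := by
    intro l
    rw [hp, hp, hp]
    by_cases hij : i = j
    · subst hij
      by_cases hl : l = i
      · subst hl; simp; ring
      · simp [hl, Ne.symm hl]; ring
    · by_cases hl : l = i
      · subst hl; simp [hij, Ne.symm hij]; ring
      · simp [hl, hij, Ne.symm hl]; ring
  have hsum : ∑ k, f (x k) = f (∑ i, x i) - profileGap f x := by rw [profileGap]; ring
  have h1 : ∑ l, f (x k) * f (x l) / profileGap f x =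
      f (x k) * (f (∑ i, x i) - profileGap f x) / profileGap f x := by
    rw [← hsum, Finset.mul_sum, Finset.sum_div]
  rw [christoffel, hg.eq_of_nhds, profileMetric_inv hpos hs hgap]
  simp only [hlow, Matrix.of_apply, mul_add, mul_ite, mul_zero, Finset.sum_add_distrib,
    Finset.sum_ite_eq', Finset.mem_univ, if_true, ← Finset.sum_mul, Finset.sum_ite_eq, h1,
    profileSecondForm]
  have := hpos i
  by_cases hij : i = j
  · subst hij
    by_cases hk : k = i
    · subst hk; simp only [if_true]; field_simp; ring
    · simp only [if_true, if_neg hk]; field_simp; ring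
  · simp only [if_neg hij]; field_simp; ring

theorem sum_mul_profileSecondForm (hpos : ∀ i, f (x i) ≠ 0) (i : Fin n) :
    ∑ m, f (x m) * profileSecondForm f i m x =
      deriv f (x i) - deriv f (∑ l, x l) / f (∑ l, x l) * (f (∑ l, x l) - profileGap f x) := by
  have hsum : ∑ k, f (x k) = f (∑ i, x i) - profileGap f x := by rw [profileGap]; ring
  simp only [profileSecondForm, mul_sub, mul_ite, mul_zero, Finset.sum_sub_distrib,
    Finset.sum_ite_eq, Finset.mem_univ, if_true, ← Finset.sum_mul, hsum]
  have := hpos i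
  field_simp

/-- `-1 / (4 Δ)` times the endomorphism associated with the second fundamental form. -/
noncomputable def profileShape (f : ℝ → ℝ) {n : ℕ} (l i : Fin n) (x : Fin n → ℝ) : ℝ :=
  -(1 / 4) / profileGap f x * ((if l = i then deriv f (x l) else 0)
    + f (x l) * deriv f (x i) / profileGap f x
    - f (x l) * deriv f (∑ m, x m) / profileGap f x)

theorem partialDeriv_christoffel_profileMetric {g : (Fin n → ℝ) → Matrix (Fin n) (Fin n) ℝ}
    (hg : g =ᶠ[𝓝 x] profileMetric f)
    (hpos : ∀ᶠ z in 𝓝 x, (∀ i, f (z i) ≠ 0) ∧ f (∑ i, z i) ≠ 0 ∧ profileGap f z ≠ 0 ∧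
      (∀ i, DifferentiableAt ℝ f (z i)) ∧ DifferentiableAt ℝ f (∑ i, z i))
    {p' : Fin n → ℝ} {P' : ℝ}
    (hp : ∀ i, HasDerivAt (fun t => deriv f t / f t) (p' i) (x i))
    (hP : HasDerivAt (fun t => deriv f t / f t) P' (∑ i, x i)) (i l j k : Fin n) :
    partialDeriv i (christoffel g l j k) x =
      -(1 / 2) * (if j = k then if l = j then if i = j then p' j else 0 else 0 else 0) +
      (-(1 / 2) * (if i = l then deriv f (x l) else 0) / profileGap f x +
        (1 / 2) * f (x l) * (deriv f (∑ m, x m) - deriv f (x i)) / profileGap f x ^ 2) *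
          profileSecondForm f j k x +
      -(1 / 2) * f (x l) / profileGap f x *
        ((if j = k then if i = j then p' j else 0 else 0) - P') := by
  obtain ⟨h1, h2, h3, h4, h5⟩ := hpos.self_of_nhds
  have hS := hasFDerivAt_comp_sum hP
  have hSf := hasFDerivAt_comp_sum h5.hasDerivAt
  have hN : HasFDerivAt (fun z => profileGap f z) _ x :=
    hSf.sub (HasFDerivAt.fun_sum fun m (_ : m ∈ Finset.univ) =>
      hasFDerivAt_comp_coord m (h4 m).hasDerivAt)
  have hB : HasFDerivAt (fun z => profileSecondForm f j k z)
      ((if j = k then p' j • (ContinuousLinearMap.proj j : (Fin n → ℝ) →L[ℝ] ℝ) else 0) -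
        P' • ∑ i, (ContinuousLinearMap.proj i : (Fin n → ℝ) →L[ℝ] ℝ)) x := by
    simp only [profileSecondForm]
    refine HasFDerivAt.fun_sub ?_ hS
    split_ifs
    · exact hasFDerivAt_comp_coord j (hp j)
    · exact hasFDerivAt_const _ _
  have hG : HasFDerivAt (fun z : Fin n → ℝ => if j = k then if l = j then
      deriv f (z j) / f (z j) else 0 else 0)
      (if j = k then if l = j then p' j • (ContinuousLinearMap.proj j : (Fin n → ℝ) →L[ℝ] ℝ)
        else 0 else 0) x := by
    split_ifs
    · exact hasFDerivAt_comp_coord j (hp j)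
    · exact hasFDerivAt_const _ _
    · exact hasFDerivAt_const _ _
  have key := (hG.const_mul (-(1 / 2))).add
    ((((hasFDerivAt_comp_coord l (h4 l).hasDerivAt).const_mul (-(1 / 2))).mul
      ((hasDerivAt_inv h3).comp_hasFDerivAt x hN)).mul hB)
  have heq : christoffel g l j k =ᶠ[𝓝 x] fun z =>
      -(1 / 2) * (if j = k then if l = j then deriv f (z j) / f (z j) else 0 else 0) +
        -(1 / 2) * f (z l) / profileGap f z * profileSecondForm f j k z := by
    filter_upwards [hpos, hg.eventuallyEq_nhds] with z hz hgz
    exact christoffel_profileMetric hgz hz.1 hz.2.1 hz.2.2.1 hz.2.2.2.1 hz.2.2.2.2 l j k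
  rw [partialDeriv_congr heq]
  refine (partialDeriv_of_hasFDerivAt (key.congr_of_eventuallyEq
    (Eventually.of_forall fun z => ?_)) i).trans ?_
  · simp only [Pi.add_apply, Pi.mul_apply, div_eq_mul_inv, Function.comp_apply]
  · have e1 : ∀ m, (ContinuousLinearMap.proj m : (Fin n → ℝ) →L[ℝ] ℝ) (Pi.single i 1) =
        if i = m then 1 else 0 := fun m => by simp [Pi.single_apply, eq_comm]
    have e2 : (∑ m, deriv f (x m) • (ContinuousLinearMap.proj m : (Fin n → ℝ) →L[ℝ] ℝ))
        (Pi.single i 1) = deriv f (x i) := by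
      rw [sum_apply]
      simp only [smul_apply, e1, smul_eq_mul, mul_ite, mul_one, mul_zero, Finset.sum_ite_eq,
        Finset.mem_univ, if_true]
    have e3 : ∀ (q : Prop) [Decidable q] (L : (Fin n → ℝ) →L[ℝ] ℝ) (v : Fin n → ℝ),
        (if q then L else 0) v = if q then L v else 0 := by
      intro q _ L v; split_ifs <;> rfl
    simp only [add_apply, sub_apply, smul_apply, sum_proj_single, e1, e2, e3, smul_eq_mul,
      mul_one, Function.comp_apply, Pi.mul_apply, mul_ite, mul_zero]
    split_ifs <;> field_simp <;> ring

theorem sum_christoffel_mul {A B : ℝ} {Γ N : Fin n → ℝ} (Ψ : Fin n → ℝ) (j k : Fin n)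
    (hΓ : ∀ m, Γ m = (if j = k then if m = j then A else 0 else 0) + N m * B) :
    ∑ m, Γ m * Ψ m = (if j = k then A * Ψ j else 0) + B * ∑ m, N m * Ψ m := by
  simp only [hΓ, add_mul, Finset.sum_add_distrib, Finset.mul_sum]
  congr 1
  · split_ifs
    · simp
    · simp
  · exact Finset.sum_congr rfl fun m _ => by ring

/-- The Gauss equation. The second derivatives of `f`, carried by `p'` and `P'`, enter `∂ᵢ Γˡⱼₖ`
symmetrically in `i, j` and cancel. -/
theorem curvature_profileMetric {g : (Fin n → ℝ) → Matrix (Fin n) (Fin n) ℝ}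
    (hg : g =ᶠ[𝓝 x] profileMetric f)
    (hpos : ∀ᶠ z in 𝓝 x, (∀ i, f (z i) ≠ 0) ∧ f (∑ i, z i) ≠ 0 ∧ profileGap f z ≠ 0 ∧
      (∀ i, DifferentiableAt ℝ f (z i)) ∧ DifferentiableAt ℝ f (∑ i, z i))
    {p' : Fin n → ℝ} {P' : ℝ}
    (hp : ∀ i, HasDerivAt (fun t => deriv f t / f t) (p' i) (x i))
    (hP : HasDerivAt (fun t => deriv f t / f t) P' (∑ i, x i)) (l i j k : Fin n) :
    curvature g l i j k x =
      profileShape f l i x * profileSecondForm f j k x -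
        profileShape f l j x * profileSecondForm f i k x := by
  obtain ⟨h1, h2, h3, h4, h5⟩ := hpos.self_of_nhds
  have hΓ := christoffel_profileMetric hg h1 h2 h3 h4 h5
  -- With `∂ᵢ Nˡ` added, this is the covariant derivative of `N`: it equals `profileShape` plus a
  -- multiple of `f (x l)`, which the diagonal part of `Γ` cancels after antisymmetrization.
  have hN : ∀ i, ∑ m, (-(1 / 2) * f (x m) / profileGap f x) * christoffel g l i m x =
      (1 / 4) * (if i = l then deriv f (x l) else 0) / profileGap f x +
      (1 / 4) * f (x l) / profileGap f x ^ 2 *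
        (deriv f (x i) - deriv f (∑ l, x l) / f (∑ l, x l) *
          (f (∑ l, x l) - profileGap f x)) := by
    intro i
    rw [← sum_mul_profileSecondForm h1 i]
    have e : ∀ m, (-(1 / 2) * f (x m) / profileGap f x) * christoffel g l i m x =
        (if i = m then (if i = l then (1 / 4) * deriv f (x l) / profileGap f x else 0) else 0) +
        (1 / 4) * f (x l) / profileGap f x ^ 2 * (f (x m) * profileSecondForm f i m x) := by
      intro m
      rw [hΓ]
      have := h1 m
      by_cases him : i = m
      · subst him
        by_cases hil : i = l
        · subst hil
          simp only [if_true]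
          field_simp
          ring
        · simp only [if_neg hil, if_neg (Ne.symm hil), if_true]
          field_simp
          ring
      · simp only [if_neg him]
        field_simp
        ring
    simp only [e, Finset.sum_add_distrib, Finset.sum_ite_eq, Finset.mem_univ, if_true,
      ← Finset.mul_sum]
    congr 1
    split_ifs <;> ring
  have hsum : ∀ i j, ∑ m, christoffel g m j k x * christoffel g l i m x = _ := fun i j =>
    sum_christoffel_mul (A := -(1 / 2) * (deriv f (x j) / f (x j)))
      (N := fun m => -(1 / 2) * f (x m) / profileGap f x)
      (B := profileSecondForm f j k x) _ j k (fun m => by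
        rw [hΓ]; congr 1; split_ifs <;> simp)
  rw [curvature, Finset.sum_sub_distrib, hsum, hsum, hN, hN, hΓ, hΓ,
    partialDeriv_christoffel_profileMetric hg hpos hp hP,
    partialDeriv_christoffel_profileMetric hg hpos hp hP]
  have hl := h1 l
  simp only [profileShape]
  rcases eq_or_ne i j with rfl | hij
  · ring
  · have hi := h1 i
    have hj := h1 j
    have hk := h1 k
    by_cases hjk : j = k
    · subst hjk
      by_cases hli : i = l
      · subst hli
        simp only [profileSecondForm, hij, hij.symm, if_true, if_false]
        field_simp
        ring
      · by_cases hlj : l = j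
        · subst hlj
          simp only [profileSecondForm, hij, hij.symm, if_true, if_false]
          field_simp
          ring
        · simp only [profileSecondForm, hij, hij.symm, hli, hlj, Ne.symm hli, Ne.symm hlj,
            if_true, if_false]
          field_simp
          ring
    · by_cases hik : i = k
      · subst hik
        by_cases hli : i = l
        · subst hli
          simp only [profileSecondForm, hij, hij.symm, if_true, if_false]
          field_simp
          ring
        · by_cases hlj : l = j
          · subst hlj
            simp only [profileSecondForm, hij, hij.symm, if_true, if_false]
            field_simp
            ring
          · simp only [profileSecondForm, hij, hij.symm, hli, hlj, Ne.symm hli, Ne.symm hlj,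
              if_true, if_false]
            field_simp
            ring
      · simp only [profileSecondForm, hij, hij.symm, hik, hjk, if_false]
        by_cases hli : i = l
        · subst hli
          simp only [hij, hij.symm, if_true, if_false]
          field_simp
          ring
        · by_cases hlj : l = j
          · subst hlj
            simp only [hij, hij.symm, if_true, if_false]
            field_simp
            ring
          · simp only [hli, hlj, Ne.symm hli, Ne.symm hlj, if_false]
            field_simp
            ring

/-- Lowering the index of the shape matrix recovers `B`; the negative factor is what fixes the sign
of the curvature. -/
theorem sum_profileMetric_mul_profileShape (hpos : ∀ i, f (x i) ≠ 0) (hs : f (∑ i, x i) ≠ 0)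
    (hgap : profileGap f x ≠ 0) (m i : Fin n) :
    ∑ l, profileMetric f x l m * profileShape f l i x =
      -(1 / 4) / profileGap f x * profileSecondForm f m i x := by
  have hsum : ∑ k, f (x k) = f (∑ i, x i) - profileGap f x := by rw [profileGap]; ring
  have h1 : ∑ l, profileShape f l i x = -(1 / 4) / profileGap f x * (deriv f (x i) +
      (f (∑ i, x i) - profileGap f x) * (deriv f (x i) - deriv f (∑ m, x m)) / profileGap f x) := by
    have e : ∀ l, profileShape f l i x = -(1 / 4) / profileGap f x *
        ((if l = i then deriv f (x l) else 0) +
          f (x l) * ((deriv f (x i) - deriv f (∑ m, x m)) / profileGap f x)) := by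
      intro l; rw [profileShape]; ring
    simp only [e, ← Finset.mul_sum, Finset.sum_add_distrib, Finset.sum_ite_eq', Finset.mem_univ,
      if_true, ← Finset.sum_mul, hsum]
    ring
  simp only [profileMetric, Matrix.of_apply, sub_mul, ite_mul, zero_mul, Finset.sum_sub_distrib,
    Finset.sum_ite_eq', Finset.mem_univ, if_true, ← Finset.mul_sum, h1]
  have hm := hpos m
  simp only [profileShape, profileSecondForm]
  split_ifs with h
  · subst h
    field_simp
    ring
  · field_simp
    ring

end

/-! ### Sign of the sectional curvature. -/

/-- A curvature tensor `R(u, v) w = ⟨v, w⟩_B A u - ⟨u, w⟩_B A v`, where `g A = c B`. -/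
theorem metricInner_curvatureVector_of_gauss {n : ℕ}
    {g : (Fin n → ℝ) → Matrix (Fin n) (Fin n) ℝ} {x : Fin n → ℝ} {A B : Fin n → Fin n → ℝ} {c : ℝ}
    (hR : ∀ l i j k, curvature g l i j k x = A l i * B j k - A l j * B i k)
    (hA : ∀ m i, ∑ l, g x l m * A l i = c * B m i) (u v : Fin n → ℝ) :
    metricInner g x (curvatureVector g x u v v) u =
      c * ((∑ i, ∑ j, B j i * u i * u j) * (∑ i, ∑ j, B i j * v i * v j) -
        (∑ i, ∑ j, B j i * v i * u j) * ∑ i, ∑ j, B i j * u i * v j) := by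
  have hcurv : ∀ l, curvatureVector g x u v v l =
      (∑ i, A l i * u i) * (∑ i, ∑ j, B i j * v i * v j) -
        (∑ i, A l i * v i) * (∑ i, ∑ j, B i j * u i * v j) := by
    intro l
    have e1 : (∑ i, A l i * u i) * (∑ i, ∑ j, B i j * v i * v j) =
        ∑ i, ∑ j, ∑ k, A l i * u i * (B j k * v j * v k) := by
      simp only [Finset.sum_mul]
      simp only [Finset.mul_sum]
    have e2 : (∑ i, A l i * v i) * (∑ i, ∑ j, B i j * u i * v j) =
        ∑ i, ∑ j, ∑ k, A l j * v j * (B i k * u i * v k) := by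
      simp only [Finset.sum_mul]
      simp only [Finset.mul_sum]
      rw [Finset.sum_comm]
    rw [e1, e2, curvatureVector]
    simp only [← Finset.sum_sub_distrib, hR]
    exact Finset.sum_congr rfl fun i _ => Finset.sum_congr rfl fun j _ =>
      Finset.sum_congr rfl fun k _ => by ring
  have hlow : ∀ w : Fin n → ℝ, ∑ l, ∑ m, g x l m * (∑ i, A l i * w i) * u m =
      c * ∑ i, ∑ m, B m i * w i * u m := by
    intro w
    calc ∑ l, ∑ m, g x l m * (∑ i, A l i * w i) * u m
        = ∑ l, ∑ m, ∑ i, g x l m * A l i * w i * u m := by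
          simp only [Finset.mul_sum, Finset.sum_mul, mul_assoc]
      _ = ∑ i, ∑ m, ∑ l, g x l m * A l i * w i * u m := by
          rw [Finset.sum_comm]
          rw [Finset.sum_comm (s := Finset.univ (α := Fin n)) (γ := Fin n) (t := Finset.univ)
            (f := fun i m => ∑ l, g x l m * A l i * w i * u m)]
          exact Finset.sum_congr rfl fun m _ => Finset.sum_comm
      _ = c * ∑ i, ∑ m, B m i * w i * u m := by
          simp only [← Finset.sum_mul, hA]
          simp only [Finset.mul_sum, mul_assoc]
  rw [metricInner]
  simp only [hcurv]
  have e : ∀ l m, g x l m * ((∑ i, A l i * u i) * (∑ i, ∑ j, B i j * v i * v j) -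
        (∑ i, A l i * v i) * (∑ i, ∑ j, B i j * u i * v j)) * u m =
      g x l m * (∑ i, A l i * u i) * u m * (∑ i, ∑ j, B i j * v i * v j) -
      g x l m * (∑ i, A l i * v i) * u m * (∑ i, ∑ j, B i j * u i * v j) := fun l m => by ring
  simp only [e, Finset.sum_sub_distrib, ← Finset.sum_mul, hlow]
  ring

/-- The strict Cauchy–Schwarz inequality for a positive definite symmetric bilinear form. -/
theorem sq_lt_mul_of_posDef {n : ℕ} {b : Fin n → Fin n → ℝ} (hsymm : ∀ i j, b i j = b j i)
    (hpos : ∀ w : Fin n → ℝ, w ≠ 0 → 0 < ∑ i, ∑ j, b i j * w i * w j) {u v : Fin n → ℝ}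
    (huv : LinearIndependent ℝ ![u, v]) :
    (∑ i, ∑ j, b i j * u i * v j) ^ 2 <
      (∑ i, ∑ j, b i j * u i * u j) * ∑ i, ∑ j, b i j * v i * v j := by
  have hquad : ∀ α β : ℝ, ∑ i, ∑ j, b i j * (α • u - β • v) i * (α • u - β • v) j =
      α ^ 2 * (∑ i, ∑ j, b i j * u i * u j) - α * β * (∑ i, ∑ j, b i j * u i * v j) -
        α * β * (∑ i, ∑ j, b i j * v i * u j) + β ^ 2 * ∑ i, ∑ j, b i j * v i * v j := by
    intro α β
    simp only [Finset.mul_sum, ← Finset.sum_sub_distrib, ← Finset.sum_add_distrib]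
    refine Finset.sum_congr rfl fun i _ => Finset.sum_congr rfl fun j _ => ?_
    simp only [Pi.sub_apply, Pi.smul_apply, smul_eq_mul]
    ring
  set E := ∑ i, ∑ j, b i j * u i * u j with hE
  set F := ∑ i, ∑ j, b i j * u i * v j with hF
  set G := ∑ i, ∑ j, b i j * v i * v j with hG
  have hF' : ∑ i, ∑ j, b i j * v i * u j = F := by
    rw [hF, Finset.sum_comm]
    exact Finset.sum_congr rfl fun i _ => Finset.sum_congr rfl fun j _ => by
      rw [hsymm]; ring
  rw [LinearIndependent.pair_iff] at huv
  have hu : u ≠ 0 := by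
    rintro rfl
    simpa using huv 1 0 (by simp)
  -- On this vector the form takes the value `E (E G - F²)`.
  have hw : F • u - E • v ≠ 0 := by
    intro h
    have := (huv F (-E) (by rw [neg_smul, ← sub_eq_add_neg, h])).2
    exact (hpos u hu).ne' (by linarith)
  have key := hpos _ hw
  rw [hquad, hF'] at key
  have hE0 := hpos u hu
  rw [← hE] at hE0
  have : 0 < E * (E * G - F ^ 2) := by linear_combination key
  exact sub_pos.1 ((mul_pos_iff_of_pos_left hE0).1 this)

theorem IsStarShapedProfile.hasNegativeSectionalCurvatureOn {f : ℝ → ℝ}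
    (hf : IsStarShapedProfile f) {n : ℕ} (hn : 2 ≤ n)
    {g : (Fin n → ℝ) → Matrix (Fin n) (Fin n) ℝ} (hg : EqOn g (profileMetric f) (orthant n)) :
    HasNegativeSectionalCurvatureOn g (orthant n) := by
  intro x hx u v huv
  have hU := isOpen_orthant n
  have hd : ∀ t > 0, DifferentiableAt ℝ f t := fun t ht =>
    (hf.contDiffOn.differentiableOn (by norm_num)).differentiableAt (Ioi_mem_nhds ht)
  have hd2 : ∀ t > 0, DifferentiableAt ℝ (deriv f) t := fun t ht =>
    ((hf.contDiffOn.deriv_of_isOpen (m := 1) isOpen_Ioi (by norm_num)).differentiableOn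
      (by norm_num)).differentiableAt (Ioi_mem_nhds ht)
  have hs : ∀ z ∈ orthant n, 0 < ∑ i, z i := fun z hz => sum_pos_of_mem_orthant (by omega) hz
  have hgap : ∀ z ∈ orthant n, 0 < profileGap f z := fun z hz =>
    sub_pos.2 (sum_lt_of_strictMonoOn_div hn hf.strictMonoOn_div hz)
  have hp : ∀ t > 0, HasDerivAt (fun t => deriv f t / f t) (deriv (fun t => deriv f t / f t) t) t :=
    fun t ht => ((hd2 t ht).div (hd t ht) (hf.pos t ht).ne').hasDerivAt
  have hR := curvature_profileMetric (hg.eventuallyEq_of_mem (hU.mem_nhds hx))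
    (by
      filter_upwards [hU.mem_nhds hx] with z hz
      exact ⟨fun i => (hf.pos _ (hz i)).ne', (hf.pos _ (hs z hz)).ne', (hgap z hz).ne',
        fun i => hd _ (hz i), hd _ (hs z hz)⟩)
    (fun i => hp _ (hx i)) (hp _ (hs x hx))
  have hA := sum_profileMetric_mul_profileShape (fun i => (hf.pos _ (hx i)).ne')
    (hf.pos _ (hs x hx)).ne' (hgap x hx).ne'
  rw [← hg hx] at hA
  rw [sectionalCurvature, metricInner_curvatureVector_of_gauss hR hA]
  -- The argument that made the metric positive definite, applied to `f / f'` instead of `f`.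
  have hBpos : ∀ w : Fin n → ℝ, w ≠ 0 →
      0 < ∑ i, ∑ j, profileSecondForm f i j x * w i * w j := by
    intro w hw
    have e := sum_diag_sub_const (fun i => f (x i) / deriv f (x i))
      (f (∑ i, x i) / deriv f (∑ i, x i)) w w
    simp only [one_div_div] at e
    simp only [profileSecondForm]
    rw [e, sub_pos]
    simpa only [sq] using sq_sum_div_lt_sum_sq_div
      (c := fun i => f (x i) / deriv f (x i))
      (fun i => div_pos (hf.pos _ (hx i)) (hf.deriv_pos _ (hx i)))
      (sum_lt_of_strictMonoOn_div (F := fun t => f t / deriv f t) hn hf.strictMonoOn_quot_div hx) hw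
  have hB := sq_lt_mul_of_posDef (fun i j => profileSecondForm_comm f i j x) hBpos huv
  have hP := (hf.isRiemannianMetricOn hn).posDef x hx
  rw [← hg hx] at hP
  have hG := sq_lt_mul_of_posDef (b := g x) (fun i j => by
      have := hP.isHermitian.apply i j
      simpa using this.symm) (fun w hw => by
      have := hP.dotProduct_mulVec_pos hw
      refine this.trans_eq ?_
      simp only [dotProduct, Matrix.mulVec, star_trivial, Finset.mul_sum]
      exact Finset.sum_congr rfl fun i _ => Finset.sum_congr rfl fun j _ => by ring) huv
  refine div_neg_of_neg_of_pos (mul_neg_of_neg_of_pos ?_ ?_) (sub_pos.2 hG)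
  · exact div_neg_of_neg_of_pos (by norm_num) (hgap x hx)
  · have e2 : ∑ i, ∑ j, profileSecondForm f j i x * v i * u j =
        ∑ i, ∑ j, profileSecondForm f i j x * u i * v j := by
      rw [Finset.sum_comm]
      exact Finset.sum_congr rfl fun i _ => Finset.sum_congr rfl fun j _ => by ring
    have e1 : ∑ i, ∑ j, profileSecondForm f j i x * u i * u j =
        ∑ i, ∑ j, profileSecondForm f i j x * u i * u j :=
      Finset.sum_congr rfl fun i _ => Finset.sum_congr rfl fun j _ => by
        rw [profileSecondForm_comm]
    rw [e1, e2, sub_pos, ← sq]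
    exact hB

/-! ### From the convexity assumptions to star-shaped profiles. -/

/-- A strictly convex function on `(0, ∞)` with limit `0` at `0` is strictly star-shaped. -/
theorem strictMonoOn_div_of_strictConvexOn {F : ℝ → ℝ} (hF : StrictConvexOn ℝ (Ioi 0) F)
    (h0 : Tendsto F (𝓝[>] 0) (𝓝 0)) : StrictMonoOn (fun t => F t / t) (Ioi 0) := by
  have hle : ∀ x y, 0 < x → x < y → F x / x ≤ F y / y := by
    intro x y hx hxy
    have hid : Tendsto (fun ε : ℝ => ε) (𝓝[>] 0) (𝓝 0) := tendsto_id.mono_left nhdsWithin_le_nhds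
    have h1 : Tendsto (fun ε => (F x - F ε) / (x - ε)) (𝓝[>] 0) (𝓝 ((F x - 0) / (x - 0))) :=
      (tendsto_const_nhds.sub h0).div (tendsto_const_nhds.sub hid) (by simpa using hx.ne')
    have h2 : Tendsto (fun ε => (F y - F ε) / (y - ε)) (𝓝[>] 0) (𝓝 ((F y - 0) / (y - 0))) :=
      (tendsto_const_nhds.sub h0).div (tendsto_const_nhds.sub hid)
        (by simpa using (hx.trans hxy).ne')
    simp only [sub_zero] at h1 h2
    refine le_of_tendsto_of_tendsto h1 h2 ?_
    filter_upwards [Ioo_mem_nhdsGT hx] with ε hε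
    exact (hF.secant_strict_mono (mem_Ioi.2 hε.1) (mem_Ioi.2 hx) (mem_Ioi.2 (hx.trans hxy))
      hε.2.ne' (hε.2.trans hxy).ne' hxy).le
  intro x hx y hy hxy
  have hx' : 0 < x := hx
  have hy' : 0 < y := hy
  refine (hle x y hx hxy).lt_of_ne fun heq => ?_
  -- The limit gave only a weak inequality. Equality at `x < y` would put the midpoint value
  -- strictly below the ray through the origin, contradicting `hle`.
  have hm := hF.2 hx hy hxy.ne (one_half_pos (α := ℝ)) one_half_pos (add_halves 1)
  simp only [smul_eq_mul] at hm
  have h1 := hle x (1 / 2 * x + 1 / 2 * y) hx (by linarith)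
  set c := F x / x with hc
  have hFx : F x = c * x := (div_mul_cancel₀ _ hx'.ne').symm
  have heq' : c = F y / y := heq
  have hFy : F y = c * y := by rw [heq', div_mul_cancel₀ _ hy'.ne']
  rw [le_div_iff₀ (by positivity)] at h1
  rw [hFx, hFy] at hm
  linarith

theorem IsAdmissibleProfile.isStarShapedProfile {f : ℝ → ℝ} (hf : IsAdmissibleProfile f) :
    IsStarShapedProfile f := by
  have hd : ∀ t > 0, DifferentiableAt ℝ f t := fun t ht =>
    hf.differentiableOn.differentiableAt (Ioi_mem_nhds ht)
  have hd2 : ∀ t > 0, DifferentiableAt ℝ (deriv f) t := fun t ht =>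
    hf.differentiableOn_deriv.differentiableAt (Ioi_mem_nhds ht)
  have hid : Tendsto (fun ε : ℝ => ε) (𝓝[>] 0) (𝓝 0) := tendsto_id.mono_left nhdsWithin_le_nhds
  have hf0 : Tendsto f (𝓝[>] 0) (𝓝 0) :=
    hf.isBigO_zero.trans_tendsto (by simpa using hid.pow 2)
  have hf0' : Tendsto (deriv f) (𝓝[>] 0) (𝓝 0) := hf.deriv_isBigO_zero.trans_tendsto hid
  have hmono' : StrictMonoOn (deriv f) (Ioi 0) :=
    strictMonoOn_of_deriv_pos (convex_Ioi 0) hf.differentiableOn_deriv.continuousOn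
      fun t ht => hf.deriv_deriv_pos t (by simpa using ht)
  have pos_of_mono : ∀ F : ℝ → ℝ, StrictMonoOn F (Ioi 0) → Tendsto F (𝓝[>] 0) (𝓝 0) →
      ∀ t > 0, 0 < F t := by
    intro F hF h0 t ht
    have h2 : 0 < t / 2 := by positivity
    refine (le_of_tendsto h0 ?_).trans_lt (hF (mem_Ioi.2 h2) (mem_Ioi.2 ht) (half_lt_self ht))
    filter_upwards [Ioo_mem_nhdsGT h2] with ε hε
    exact (hF hε.1 (mem_Ioi.2 h2) hε.2).le
  have hpos' := pos_of_mono _ hmono' hf0'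
  have hconv : StrictConvexOn ℝ (Ioi 0) f :=
    StrictMonoOn.strictConvexOn_of_deriv (convex_Ioi 0) hf.differentiableOn.continuousOn
      (by simpa using hmono')
  have hmono : StrictMonoOn f (Ioi 0) :=
    strictMonoOn_of_deriv_pos (convex_Ioi 0) hf.differentiableOn.continuousOn
      fun t ht => hpos' t (by simpa using ht)
  have hpos := pos_of_mono _ hmono hf0
  -- Secants from points near `0` have slope at most `f' t`; in the limit `f t ≤ t f' t`. This
  -- squeezes `f / f'` to `0` at the origin.
  have hle : ∀ t > 0, f t / deriv f t ≤ t := by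
    intro t ht
    rw [div_le_iff₀ (hpos' t ht)]
    have h1 : Tendsto (fun ε => f t - f ε) (𝓝[>] 0) (𝓝 (f t - 0)) := tendsto_const_nhds.sub hf0
    have h2 : Tendsto (fun ε => deriv f t * (t - ε)) (𝓝[>] 0) (𝓝 (deriv f t * (t - 0))) :=
      (tendsto_const_nhds.sub hid).const_mul _
    have := le_of_tendsto_of_tendsto h1 h2 (by
      filter_upwards [Ioo_mem_nhdsGT ht] with ε hε
      have := hconv.convexOn.slope_le_deriv (mem_Ioi.2 hε.1) (mem_Ioi.2 ht) hε.2 (hd t ht)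
      rwa [slope_def_field, div_le_iff₀ (sub_pos.2 hε.2)] at this)
    simpa [mul_comm] using this
  have hquot0 : Tendsto (fun t => f t / deriv f t) (𝓝[>] 0) (𝓝 0) := by
    refine tendsto_of_tendsto_of_tendsto_of_le_of_le' tendsto_const_nhds hid ?_ ?_
    · filter_upwards [self_mem_nhdsWithin] with t ht
      exact (div_pos (hpos t ht) (hpos' t ht)).le
    · filter_upwards [self_mem_nhdsWithin] with t ht using hle t ht
  have hqconv : StrictConvexOn ℝ (Ioi 0) fun t => f t / deriv f t :=
    StrictMonoOn.strictConvexOn_of_deriv (convex_Ioi 0) hf.differentiableOn_quot.continuousOn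
      (by
        rw [interior_Ioi]
        exact strictMonoOn_of_deriv_pos (convex_Ioi 0) hf.differentiableOn_deriv_quot.continuousOn
          fun t ht => hf.deriv_deriv_quot_pos t (by simpa using ht))
  -- Continuity of `f''` is not assumed; it comes from solving `(f / f')' = 1 - f f'' / f'²` for
  -- `f''`.
  have hf2 : ContinuousOn (deriv (deriv f)) (Ioi 0) := by
    have h1 : ContinuousOn (fun t => (1 - deriv (fun y => f y / deriv f y) t) * deriv f t ^ 2 / f t)
        (Ioi 0) :=
      ((continuousOn_const.sub hf.differentiableOn_deriv_quot.continuousOn).mul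
        (hf.differentiableOn_deriv.continuousOn.pow 2)).div hf.differentiableOn.continuousOn
        fun t ht => (hpos t ht).ne'
    refine h1.congr fun t ht => ?_
    have h2 := hpos t ht
    have h3 := hpos' t ht
    have : deriv (fun y => f y / deriv f y) t =
        (deriv f t * deriv f t - f t * deriv (deriv f) t) / deriv f t ^ 2 :=
      ((hd t ht).hasDerivAt.div (hd2 t ht).hasDerivAt h3.ne').deriv
    simp only [this]
    field_simp
    ring
  refine ⟨?_, hpos, hpos', strictMonoOn_div_of_strictConvexOn hconv hf0,
    strictMonoOn_div_of_strictConvexOn hqconv hquot0⟩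
  rw [show (2 : WithTop ℕ∞) = 1 + 1 by norm_num, contDiffOn_succ_iff_deriv_of_isOpen isOpen_Ioi]
  refine ⟨hf.differentiableOn, by simp, ?_⟩
  rw [show (1 : WithTop ℕ∞) = 0 + 1 by norm_num, contDiffOn_succ_iff_deriv_of_isOpen isOpen_Ioi]
  exact ⟨hf.differentiableOn_deriv, by simp, contDiffOn_zero.2 hf2⟩

/-! ### The series `∑ₖ 1 / (x + k) ^ p` -/

/-- The Hurwitz zeta value `∑ₖ 1 / (x + k) ^ p`. -/
noncomputable def hurwitzSum (p : ℕ) (x : ℝ) : ℝ := ∑' k : ℕ, 1 / (x + k) ^ p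

theorem summable_hurwitzSum {p : ℕ} (hp : 2 ≤ p) {x : ℝ} (hx : 0 < x) :
    Summable fun k : ℕ => 1 / (x + k) ^ p := by
  rw [← summable_nat_add_iff 1]
  refine Summable.of_nonneg_of_le (fun k => by positivity) (fun k => ?_)
    ((summable_nat_add_iff 1).2 (Real.summable_one_div_nat_pow.2 (show 1 < p by omega)))
  gcongr
  exact le_add_of_nonneg_left hx.le

theorem hasSum_hurwitzSum {p : ℕ} (hp : 2 ≤ p) {x : ℝ} (hx : 0 < x) :
    HasSum (fun k : ℕ => 1 / (x + k) ^ p) (hurwitzSum p x) :=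
  (summable_hurwitzSum hp hx).hasSum

theorem hurwitzSum_pos {p : ℕ} (hp : 2 ≤ p) {x : ℝ} (hx : 0 < x) : 0 < hurwitzSum p x :=
  (summable_hurwitzSum hp hx).tsum_pos (fun k => by positivity) 0 (by simpa using pow_pos hx p)

theorem hurwitzSum_eq_add {p : ℕ} (hp : 2 ≤ p) {x : ℝ} (hx : 0 < x) :
    hurwitzSum p x = 1 / x ^ p + hurwitzSum p (x + 1) := by
  rw [hurwitzSum, (summable_hurwitzSum hp hx).tsum_eq_zero_add, hurwitzSum]
  simp [add_assoc, add_comm (1 : ℝ)]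

theorem tendsto_hurwitzSum_add_nat {p : ℕ} (x : ℝ) :
    Tendsto (fun N : ℕ => hurwitzSum p (x + N)) atTop (𝓝 0) := by
  refine (tendsto_sum_nat_add fun k : ℕ => 1 / (x + k) ^ p).congr fun N => ?_
  simp [hurwitzSum, add_assoc, add_comm (N : ℝ)]

theorem mul_hurwitzSum_succ_le {p : ℕ} (hp : 2 ≤ p) {x : ℝ} (hx : 0 < x) :
    x * hurwitzSum (p + 1) x ≤ hurwitzSum p x := by
  refine hasSum_le (fun k => ?_) ((hasSum_hurwitzSum (p := p + 1) (by omega) hx).mul_left x)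
    (hasSum_hurwitzSum hp hx)
  have : 0 < x + k := by positivity
  rw [mul_one_div, div_le_div_iff₀ (by positivity) (by positivity), pow_succ', one_mul]
  gcongr
  simp

theorem tendsto_mul_hurwitzSum_add_nat {p : ℕ} (hp : 2 ≤ p) {x : ℝ} (hx : 0 < x) :
    Tendsto (fun N : ℕ => (x + N) * hurwitzSum (p + 1) (x + N)) atTop (𝓝 0) := by
  refine squeeze_zero (fun N => ?_) (fun N => mul_hurwitzSum_succ_le hp (by positivity))
    (tendsto_hurwitzSum_add_nat x)
  exact mul_nonneg (by positivity) (hurwitzSum_pos (by omega) (by positivity)).le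

theorem tendsto_one_div_pow_add_nat {p : ℕ} (hp : 2 ≤ p) {x : ℝ} (hx : 0 < x) :
    Tendsto (fun N : ℕ => 1 / (x + N) ^ p) atTop (𝓝 0) :=
  (summable_hurwitzSum hp hx).tendsto_atTop_zero

theorem hasDerivAt_hurwitzSum {p : ℕ} (hp : 2 ≤ p) {x : ℝ} (hx : 0 < x) :
    HasDerivAt (hurwitzSum p) (-p * hurwitzSum (p + 1) x) x := by
  -- On `(x / 2, ∞)` the differentiated terms are dominated by their values at `x / 2`.
  have h2 : 0 < x / 2 := by positivity
  have h := hasDerivAt_tsum_of_isPreconnected (t := Ioi (x / 2)) (y₀ := x) (y := x)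
    (g := fun (k : ℕ) (y : ℝ) => 1 / (y + k) ^ p)
    (g' := fun (k : ℕ) (y : ℝ) => -p * (1 / (y + k) ^ (p + 1)))
    ((summable_hurwitzSum (p := p + 1) (by omega) h2).mul_left (p : ℝ))
    isOpen_Ioi isPreconnected_Ioi ?_ ?_ (half_lt_self hx) (summable_hurwitzSum hp hx)
    (half_lt_self hx)
  · rwa [tsum_mul_left] at h
  · intro k y hy
    have hy' : 0 < y := h2.trans hy
    have : 0 < y + k := by positivity
    have h1 := (((hasDerivAt_id y).add_const (k : ℝ)).pow p).inv (pow_pos this p).ne'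
    simp only [one_div]
    refine h1.congr_deriv ?_
    obtain ⟨q, rfl⟩ : ∃ q, p = q + 1 := ⟨p - 1, by omega⟩
    simp only [id_eq, Nat.add_sub_cancel, Pi.pow_apply]
    field_simp
    ring
  · intro k y hy
    have hy' : x / 2 < y := hy
    have : 0 < y := h2.trans hy
    rw [norm_mul, norm_neg, Real.norm_natCast, Real.norm_of_nonneg (by positivity)]
    gcongr

theorem contDiffOn_hurwitzSum (m : ℕ) {p : ℕ} (hp : 2 ≤ p) :
    ContDiffOn ℝ m (hurwitzSum p) (Ioi 0) := by
  induction m generalizing p with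
  | zero =>
    exact contDiffOn_zero.2 fun x hx =>
      (hasDerivAt_hurwitzSum hp hx).continuousAt.continuousWithinAt
  | succ m ih =>
    rw [Nat.cast_succ, contDiffOn_succ_iff_deriv_of_isOpen isOpen_Ioi]
    refine ⟨fun x hx => (hasDerivAt_hurwitzSum hp hx).differentiableAt.differentiableWithinAt,
      by simp, ?_⟩
    exact (contDiffOn_const.mul (ih (p := p + 1) (by omega))).congr
      fun x hx => (hasDerivAt_hurwitzSum hp hx).deriv

/-! ### Inequalities between these series -/

/-- A function that strictly decreases under unit steps and tends to `0` along them is positive. -/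
theorem pos_of_succ_lt {F : ℝ → ℝ} (h : ∀ x > 0, F (x + 1) < F x)
    (h0 : ∀ x > 0, Tendsto (fun N : ℕ => F (x + N)) atTop (𝓝 0)) {x : ℝ} (hx : 0 < x) :
    0 < F x := by
  refine (le_of_tendsto' (h0 (x + 1) (by positivity)) fun N => ?_).trans_lt (h x hx)
  induction N with
  | zero => simp
  | succ N ih =>
    refine (h (x + 1 + N) (by positivity)).le.trans ih |>.trans_eq' ?_
    push_cast
    ring_nf

/-- Discrete form of the comparison with `∫ 3 t⁻⁴ dt` over `(x, ∞)`. -/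
theorem one_div_pow_three_lt_hurwitzSum_four {x : ℝ} (hx : 0 < x) :
    1 / x ^ 3 < 3 * hurwitzSum 4 x := by
  rw [← sub_pos]
  refine pos_of_succ_lt (F := fun x => 3 * hurwitzSum 4 x - 1 / x ^ 3) (fun x hx => ?_)
    (fun x hx => ?_) hx
  · rw [hurwitzSum_eq_add (by norm_num) hx, ← sub_pos]
    have : 3 * (1 / x ^ 4 + hurwitzSum 4 (x + 1)) - 1 / x ^ 3 -
        (3 * hurwitzSum 4 (x + 1) - 1 / (x + 1) ^ 3) =
        (6 * x ^ 2 + 8 * x + 3) / (x ^ 4 * (x + 1) ^ 3) := by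
      field_simp
      ring
    rw [this]
    positivity
  · simpa using ((tendsto_hurwitzSum_add_nat x).const_mul 3).sub
      (tendsto_one_div_pow_add_nat (p := 3) (by norm_num) hx)

theorem two_mul_hurwitzSum_three_lt {x : ℝ} (hx : 0 < x) :
    2 * hurwitzSum 3 (x + 1) < 1 / x ^ 2 := by
  rw [← sub_pos]
  refine pos_of_succ_lt (F := fun x => 1 / x ^ 2 - 2 * hurwitzSum 3 (x + 1)) (fun x hx => ?_)
    (fun x hx => ?_) hx
  · rw [hurwitzSum_eq_add (by norm_num) (show 0 < x + 1 by positivity), ← sub_pos]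
    have : 1 / x ^ 2 - 2 * (1 / (x + 1) ^ 3 + hurwitzSum 3 (x + 1 + 1)) -
        (1 / (x + 1) ^ 2 - 2 * hurwitzSum 3 (x + 1 + 1)) =
        (3 * x + 1) / (x ^ 2 * (x + 1) ^ 3) := by
      field_simp
      ring
    rw [this]
    positivity
  · have h1 := (tendsto_one_div_pow_add_nat (p := 2) le_rfl hx).sub
      ((tendsto_hurwitzSum_add_nat (p := 3) (x + 1)).const_mul 2)
    simpa [add_right_comm] using h1

/-- Makes `x S₂` strictly decreasing. The drop of the difference over a unit step is exactly the gap
in `two_mul_hurwitzSum_three_lt`. -/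
theorem hurwitzSum_two_lt {x : ℝ} (hx : 0 < x) : hurwitzSum 2 x < 2 * x * hurwitzSum 3 x := by
  rw [← sub_pos]
  refine pos_of_succ_lt (F := fun x => 2 * x * hurwitzSum 3 x - hurwitzSum 2 x) (fun x hx => ?_)
    (fun x hx => ?_) hx
  · rw [hurwitzSum_eq_add (p := 3) (by norm_num) hx, hurwitzSum_eq_add (p := 2) le_rfl hx, ← sub_pos]
    have : 2 * x * (1 / x ^ 3 + hurwitzSum 3 (x + 1)) - (1 / x ^ 2 + hurwitzSum 2 (x + 1)) -
        (2 * (x + 1) * hurwitzSum 3 (x + 1) - hurwitzSum 2 (x + 1)) =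
        1 / x ^ 2 - 2 * hurwitzSum 3 (x + 1) := by
      field_simp
      ring
    rw [this]
    exact sub_pos.2 (two_mul_hurwitzSum_three_lt hx)
  · simpa [mul_assoc] using ((tendsto_mul_hurwitzSum_add_nat (p := 2) le_rfl hx).const_mul 2).sub
      (tendsto_hurwitzSum_add_nat x)

/-- Equivalent to positivity of the derivative of `x² S₃(x + 1)`. The unit-step drop is controlled
by `one_div_pow_three_lt_hurwitzSum_four` at `x + 2`. -/
theorem three_mul_hurwitzSum_four_lt {x : ℝ} (hx : 0 < x) :
    3 * x * hurwitzSum 4 (x + 1) < 2 * hurwitzSum 3 (x + 1) := by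
  rw [← sub_pos]
  refine pos_of_succ_lt (F := fun x => 2 * hurwitzSum 3 (x + 1) - 3 * x * hurwitzSum 4 (x + 1))
    (fun x hx => ?_) (fun x hx => ?_) hx
  · have hx1 : 0 < x + 1 := by positivity
    have hx2 : 0 < x + 1 + 1 := by positivity
    rw [hurwitzSum_eq_add (p := 3) (by norm_num) hx1,
      hurwitzSum_eq_add (p := 4) (by norm_num) hx1, ← sub_pos]
    have : 2 * (1 / (x + 1) ^ 3 + hurwitzSum 3 (x + 1 + 1)) -
        3 * x * (1 / (x + 1) ^ 4 + hurwitzSum 4 (x + 1 + 1)) -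
        (2 * hurwitzSum 3 (x + 1 + 1) - 3 * (x + 1) * hurwitzSum 4 (x + 1 + 1)) =
        3 * hurwitzSum 4 (x + 1 + 1) - 1 / (x + 1 + 1) ^ 3 +
          (6 * x ^ 2 + 20 * x + 17) / ((x + 1) ^ 4 * (x + 1 + 1) ^ 3) := by
      field_simp
      ring
    rw [this]
    have := one_div_pow_three_lt_hurwitzSum_four hx2
    have : 0 < (6 * x ^ 2 + 20 * x + 17) / ((x + 1) ^ 4 * (x + 1 + 1) ^ 3) := by positivity
    linarith
  · have h2 := (tendsto_mul_hurwitzSum_add_nat (p := 3) (by norm_num)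
      (show 0 < x + 1 by positivity)).const_mul 3
    have h3 := (tendsto_hurwitzSum_add_nat (p := 4) (x + 1)).const_mul 3
    have h4 := ((tendsto_hurwitzSum_add_nat (p := 3) (x + 1)).const_mul 2).sub (h2.sub h3)
    simp only [mul_zero, sub_zero] at h4
    refine h4.congr fun N => ?_
    rw [add_right_comm x 1]
    ring

/-- The summand of the telescoping expansion of `x * hurwitzSum 3 x`. -/
noncomputable def telescopeTerm (x : ℝ) : ℝ := 1 / x ^ 2 - hurwitzSum 3 (x + 1)

theorem hasSum_of_telescope {a F : ℕ → ℝ} {b : ℕ → ℝ} (hb : Summable b) (hab : ∀ k, ‖a k‖ ≤ b k)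
    (haF : ∀ k, a k = F k - F (k + 1)) (hF : Tendsto F atTop (𝓝 0)) : HasSum a (F 0) := by
  rw [(Summable.of_norm_bounded hb hab).hasSum_iff_tendsto_nat]
  have : ∀ N, ∑ k ∈ Finset.range N, a k = F 0 - F N := fun N => by
    simp only [haF, Finset.sum_range_sub']
  simp only [this]
  simpa using hF.const_sub (F 0)

theorem hasSum_telescopeTerm {x : ℝ} (hx : 0 < x) :
    HasSum (fun k : ℕ => telescopeTerm (x + k)) (x * hurwitzSum 3 x) := by
  have := hasSum_of_telescope (a := fun k : ℕ => telescopeTerm (x + k))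
    (F := fun k : ℕ => (x + k) * hurwitzSum 3 (x + k)) (summable_hurwitzSum (p := 2) le_rfl hx)
    (fun k => ?_) (fun k => ?_) (tendsto_mul_hurwitzSum_add_nat le_rfl hx)
  · simpa using this
  · have hk : 0 < x + k := by positivity
    have h1 := two_mul_hurwitzSum_three_lt hk
    have h2 := hurwitzSum_pos (p := 3) (by norm_num) (show 0 < x + k + 1 by positivity)
    rw [telescopeTerm, Real.norm_of_nonneg (by linarith)]
    linarith
  · have hk : 0 < x + k := by positivity
    rw [telescopeTerm, hurwitzSum_eq_add (by norm_num) hk]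
    push_cast
    rw [← add_assoc]
    field_simp
    ring

/-- The formal derivative of `hasSum_telescopeTerm`, proved by telescoping again instead of
differentiating under the sum. -/
theorem hasSum_deriv_telescopeTerm {x : ℝ} (hx : 0 < x) :
    HasSum (fun k : ℕ => 3 * hurwitzSum 4 (x + k + 1) - 2 / (x + k) ^ 3)
      (hurwitzSum 3 x - 3 * x * hurwitzSum 4 x) := by
  have := hasSum_of_telescope (a := fun k : ℕ => 3 * hurwitzSum 4 (x + k + 1) - 2 / (x + k) ^ 3)
    (F := fun k : ℕ => hurwitzSum 3 (x + k) - 3 * ((x + k) * hurwitzSum 4 (x + k)))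
    ((summable_hurwitzSum (p := 3) (by norm_num) hx).mul_left 2)
    (fun k => ?_) (fun k => ?_) ?_
  · simpa [mul_assoc] using this
  · have hk : 0 < x + k := by positivity
    have h1 := two_mul_hurwitzSum_three_lt hk
    have h2 := hurwitzSum_pos (p := 4) (by norm_num) (show 0 < x + k + 1 by positivity)
    have h3 := three_mul_hurwitzSum_four_lt hk
    have h4 : 3 * hurwitzSum 4 (x + k + 1) < 1 / (x + k) ^ 3 := by
      have e : 1 / (x + k) ^ 3 = 1 / (x + k) ^ 2 / (x + k) := by field_simp
      rw [e, lt_div_iff₀ hk]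
      linarith
    have h5 : 0 < 1 / (x + k) ^ 3 := by positivity
    rw [Real.norm_eq_abs, abs_le, mul_one_div]
    rw [show (2 : ℝ) / (x + k) ^ 3 = 2 * (1 / (x + k) ^ 3) by ring]
    constructor <;> linarith
  · have hk : 0 < x + k := by positivity
    rw [hurwitzSum_eq_add (p := 3) (by norm_num) hk, hurwitzSum_eq_add (p := 4) (by norm_num) hk]
    push_cast
    rw [← add_assoc]
    field_simp
    ring
  · simpa using (tendsto_hurwitzSum_add_nat (p := 3) x).sub
      ((tendsto_mul_hurwitzSum_add_nat (p := 3) (by norm_num) hx).const_mul 3)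

/-- The function equals `1 - x² S₃(x + 1)`. Its monotonicity is one half of the Chebyshev argument;
the other is that of `1 / x`. -/
theorem strictAntiOn_sq_mul_telescopeTerm :
    StrictAntiOn (fun x => x ^ 2 * telescopeTerm x) (Ioi 0) := by
  have hd : ∀ x > 0, HasDerivAt (fun x => 1 - x ^ 2 * hurwitzSum 3 (x + 1))
      (-(x * (2 * hurwitzSum 3 (x + 1) - 3 * x * hurwitzSum 4 (x + 1)))) x := by
    intro x hx
    have h1 := (hasDerivAt_hurwitzSum (p := 3) (by norm_num)
      (show 0 < x + 1 by positivity)).comp_add_const x 1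
    refine (((hasDerivAt_pow 2 x).mul h1).const_sub 1).congr_deriv ?_
    push_cast
    ring
  have h : StrictAntiOn (fun x => 1 - x ^ 2 * hurwitzSum 3 (x + 1)) (Ioi 0) := by
    refine strictAntiOn_of_deriv_neg (convex_Ioi 0)
      (fun x hx => (hd x hx).continuousAt.continuousWithinAt) fun x hx => ?_
    have hx : 0 < x := by simpa using hx
    rw [(hd x hx).deriv]
    exact neg_neg_of_pos (mul_pos hx (sub_pos.2 (three_mul_hurwitzSum_four_lt hx)))
  refine h.congr fun x hx => ?_
  have hx : x ≠ 0 := ne_of_gt hx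
  simp only [telescopeTerm]
  field_simp

/-- The Chebyshev-type inequality expressing that `x * hurwitzSum 3 x / hurwitzSum 2 x` has negative
derivative. -/
theorem hurwitzSum_mul_lt {x : ℝ} (hx : 0 < x) :
    (hurwitzSum 3 x - 3 * x * hurwitzSum 4 x) * hurwitzSum 2 x + 2 * x * hurwitzSum 3 x ^ 2 < 0 := by
  have h2 := hurwitzSum_pos (p := 2) le_rfl hx
  have h3 := hurwitzSum_pos (p := 3) (by norm_num) hx
  -- `b` is the mean of `1 / (x + k)` with weights `(x + k)⁻²`, and `r` is the value of `y²
  -- telescopeTerm y` where `1 / y = b`.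
  set b := hurwitzSum 3 x / hurwitzSum 2 x with hb
  have hb0 : 0 < b := div_pos h3 h2
  set r := (1 / b) ^ 2 * telescopeTerm (1 / b) with hr
  -- The part multiplied by `2 * r` sums to `S₃ - b S₂ = 0`; adding it makes every summand negative.
  have hS := ((hasSum_deriv_telescopeTerm hx).add ((hasSum_telescopeTerm hx).mul_left (2 * b))).add
    (((hasSum_hurwitzSum (p := 3) (by norm_num) hx).sub
      ((hasSum_hurwitzSum (p := 2) le_rfl hx).mul_left b)).mul_left (2 * r))
  have hneg : ∀ k : ℕ, 3 * hurwitzSum 4 (x + k + 1) - 2 / (x + k) ^ 3 +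
      2 * b * telescopeTerm (x + k) +
      2 * r * (1 / (x + k) ^ 3 - b * (1 / (x + k) ^ 2)) < 0 := by
    intro k
    have hk : 0 < x + k := by positivity
    set y := x + k with hy
    have hG : 0 < (2 * hurwitzSum 3 (y + 1) - 3 * y * hurwitzSum 4 (y + 1)) / y :=
      div_pos (sub_pos.2 (three_mul_hurwitzSum_four_lt hk)) hk
    -- Both factors are decreasing in `y` and vanish at `y = 1 / b`.
    have hcheb : 0 ≤ (y ^ 2 * telescopeTerm y - r) * (1 / y - b) := by
      rcases le_total y (1 / b) with h | h
      · exact mul_nonneg (sub_nonneg.2 (strictAntiOn_sq_mul_telescopeTerm.antitoneOn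
          (mem_Ioi.2 hk) (mem_Ioi.2 (by positivity)) h))
          (sub_nonneg.2 ((le_one_div hk hb0).1 h))
      · exact mul_nonneg_of_nonpos_of_nonpos
          (sub_nonpos.2 (strictAntiOn_sq_mul_telescopeTerm.antitoneOn
            (mem_Ioi.2 (by positivity)) (mem_Ioi.2 hk) h))
          (sub_nonpos.2 ((one_div_le hb0 hk).1 h))
    have e : 3 * hurwitzSum 4 (y + 1) - 2 / y ^ 3 + 2 * b * telescopeTerm y +
        2 * r * (1 / y ^ 3 - b * (1 / y ^ 2)) =
        -((2 * hurwitzSum 3 (y + 1) - 3 * y * hurwitzSum 4 (y + 1)) / y) -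
          2 / y ^ 2 * ((y ^ 2 * telescopeTerm y - r) * (1 / y - b)) := by
      rw [telescopeTerm]
      field_simp
      ring
    rw [e]
    have := mul_nonneg (show 0 ≤ 2 / y ^ 2 by positivity) hcheb
    linarith
  have hlt := hasSum_lt (fun k => (hneg k).le) (hneg 0) hS hasSum_zero
  have hbz : hurwitzSum 3 x = b * hurwitzSum 2 x := (div_mul_cancel₀ _ h2.ne').symm
  have e : (hurwitzSum 3 x - 3 * x * hurwitzSum 4 x) * hurwitzSum 2 x +
      2 * x * hurwitzSum 3 x ^ 2 = (hurwitzSum 3 x - 3 * x * hurwitzSum 4 x +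
        2 * b * (x * hurwitzSum 3 x) + 2 * r * (hurwitzSum 3 x - b * hurwitzSum 2 x)) *
          hurwitzSum 2 x := by
    linear_combination (2 * x * hurwitzSum 3 x - 2 * r * hurwitzSum 2 x) * hbz
  rw [e]
  exact mul_neg_of_neg_of_pos hlt h2

/-- Here `f / x = 1 / (x S₂)` and `f / (x f') = 1 / (2 x S₃ / S₂)`, so both conditions concern
strictly decreasing denominators. -/
theorem isStarShapedProfile_one_div_hurwitzSum :
    IsStarShapedProfile fun x => 1 / hurwitzSum 2 x := by
  have hpos : ∀ x > 0, 0 < hurwitzSum 2 x := fun x hx => hurwitzSum_pos le_rfl hx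
  have hpos3 : ∀ x > 0, 0 < hurwitzSum 3 x := fun x hx => hurwitzSum_pos (by norm_num) hx
  have hd2 : ∀ x > 0, HasDerivAt (hurwitzSum 2) (-2 * hurwitzSum 3 x) x := fun x hx =>
    (hasDerivAt_hurwitzSum le_rfl hx).congr_deriv (by norm_num)
  have hd3 : ∀ x > 0, HasDerivAt (hurwitzSum 3) (-3 * hurwitzSum 4 x) x := fun x hx =>
    (hasDerivAt_hurwitzSum (by norm_num) hx).congr_deriv (by norm_num)
  have hder : ∀ x > 0, deriv (fun x => 1 / hurwitzSum 2 x) x =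
      2 * hurwitzSum 3 x / hurwitzSum 2 x ^ 2 := by
    intro x hx
    simp only [one_div]
    refine (((hd2 x hx).inv (hpos x hx).ne').congr_deriv ?_).deriv
    ring
  have hanti2 : StrictAntiOn (fun x => x * hurwitzSum 2 x) (Ioi 0) := by
    have hd : ∀ x > 0, HasDerivAt (fun x => x * hurwitzSum 2 x)
        (hurwitzSum 2 x - 2 * x * hurwitzSum 3 x) x := fun x hx =>
      ((hasDerivAt_id x).mul (hd2 x hx)).congr_deriv (by simp only [id_eq]; ring)
    refine strictAntiOn_of_deriv_neg (convex_Ioi 0)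
      (fun x hx => (hd x hx).continuousAt.continuousWithinAt) fun x hx => ?_
    have hx : 0 < x := by simpa using hx
    rw [(hd x hx).deriv]
    exact sub_neg.2 (hurwitzSum_two_lt hx)
  have hanti3 : StrictAntiOn (fun x => x * hurwitzSum 3 x / hurwitzSum 2 x) (Ioi 0) := by
    have hd : ∀ x > 0, HasDerivAt (fun x => x * hurwitzSum 3 x / hurwitzSum 2 x)
        (((hurwitzSum 3 x - 3 * x * hurwitzSum 4 x) * hurwitzSum 2 x +
          2 * x * hurwitzSum 3 x ^ 2) / hurwitzSum 2 x ^ 2) x := fun x hx =>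
      (((hasDerivAt_id x).mul (hd3 x hx)).div (hd2 x hx) (hpos x hx).ne').congr_deriv
        (by simp only [id_eq, Pi.mul_apply]; ring)
    refine strictAntiOn_of_deriv_neg (convex_Ioi 0)
      (fun x hx => (hd x hx).continuousAt.continuousWithinAt) fun x hx => ?_
    have hx : 0 < x := by simpa using hx
    rw [(hd x hx).deriv]
    exact div_neg_of_neg_of_pos (hurwitzSum_mul_lt hx) (pow_pos (hpos x hx) 2)
  refine ⟨?_, fun x hx => one_div_pos.2 (hpos x hx), fun x hx => ?_, ?_, ?_⟩
  · exact contDiffOn_const.div (contDiffOn_hurwitzSum 2 le_rfl) fun x hx => (hpos x hx).ne'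
  · rw [hder x hx]
    exact div_pos (mul_pos two_pos (hpos3 x hx)) (pow_pos (hpos x hx) 2)
  · intro x hx y hy hxy
    have := one_div_lt_one_div_of_lt (mul_pos hy (hpos y hy)) (hanti2 hx hy hxy)
    simpa only [div_div, mul_comm] using this
  · have key : StrictMonoOn (fun x => 1 / (2 * (x * hurwitzSum 3 x / hurwitzSum 2 x))) (Ioi 0) :=
      fun x hx y hy hxy => one_div_lt_one_div_of_lt
        (mul_pos two_pos (div_pos (mul_pos hy (hpos3 y hy)) (hpos y hy)))
        (mul_lt_mul_of_pos_left (hanti3 hx hy hxy) two_pos)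
    refine key.congr fun x hx => ?_
    have h1 := hpos x hx
    have h2 := hpos3 x hx
    have h3 : x ≠ 0 := ne_of_gt hx
    simp only [hder x hx]
    field_simp

/-! ### The trigamma function as a series -/

/-- The summands of the series `ψ(x) + 1 / x = ∑ₙ (log (n + 1) - log n - 1 / (x + n + 1))`
(where `log 0 = 0`). -/
noncomputable def digammaTerm (n : ℕ) (x : ℝ) : ℝ :=
  Real.log (n + 1) - Real.log n - 1 / (x + n + 1)

theorem norm_digammaTerm_le {R x : ℝ} (hx : x ∈ Ioo 0 R) (n : ℕ) :
    ‖digammaTerm n x‖ ≤ 4 * (R + 1) * (1 / ((n : ℝ) + 1) ^ 2) := by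
  obtain ⟨h0, hR⟩ := hx
  rw [Real.norm_eq_abs, digammaTerm]
  -- The convention `log 0 = 0` makes the term `n = 0` exceptional; for `n ≥ 1`, `log (n + 1) - log
  -- n` lies between `1 / (n + 1)` and `1 / n`.
  rcases Nat.eq_zero_or_pos n with rfl | hn
  · have : 1 / (x + 1) ≤ 1 := by rw [div_le_one (by positivity)]; linarith
    have h2 : 0 < 1 / (x + 1) := by positivity
    simp only [Nat.cast_zero, zero_add, Real.log_one, Real.log_zero, sub_zero, add_zero, zero_sub,
      abs_neg, abs_of_pos h2]
    norm_num
    rw [one_div] at this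
    linarith
  · have hn' : (1 : ℝ) ≤ n := by exact_mod_cast hn
    have hn0 : (0 : ℝ) < n := by linarith
    have hlog : Real.log (n + 1) - Real.log n = Real.log ((n + 1) / n) :=
      (Real.log_div (by positivity) hn0.ne').symm
    have hu : Real.log (n + 1) - Real.log n ≤ 1 / n := by
      rw [hlog]
      refine (Real.log_le_sub_one_of_pos (by positivity)).trans_eq ?_
      field_simp
      ring
    have hl : 1 / (n + 1) ≤ Real.log (n + 1) - Real.log n := by
      rw [hlog]
      refine (Real.one_sub_inv_le_log_of_pos (by positivity)).trans_eq' ?_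
      field_simp
      ring
    have h1 : 1 / (x + n + 1) ≤ 1 / ((n : ℝ) + 1) :=
      one_div_le_one_div_of_le (by positivity) (by linarith)
    rw [abs_of_nonneg (by linarith)]
    have h2 : 1 / (n : ℝ) - 1 / (x + n + 1) = (x + 1) / (n * (x + n + 1)) := by
      field_simp
      ring
    have h3 : (x + 1) / (n * (x + n + 1)) ≤ 4 * (R + 1) * (1 / ((n : ℝ) + 1) ^ 2) := by
      rw [mul_one_div]
      refine (div_le_div_of_nonneg_left (by positivity) (by positivity)
        (show ((n : ℝ) + 1) ^ 2 / 4 ≤ n * (x + n + 1) by nlinarith)).trans ?_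
      rw [div_div_eq_mul_div]
      gcongr ?_ / _
      linarith
    linarith

theorem summable_one_div_nat_add_one_sq : Summable fun n : ℕ => 1 / ((n : ℝ) + 1) ^ 2 := by
  simpa [add_comm] using summable_hurwitzSum (p := 2) le_rfl one_pos

theorem hasDerivAt_logGammaSeq {x : ℝ} (hx : 0 < x) (N : ℕ) :
    HasDerivAt (fun y => Real.BohrMollerup.logGammaSeq y N)
      (∑ n ∈ Finset.range N, digammaTerm n x - 1 / x) x := by
  have h1 : HasDerivAt (fun y => ∑ m ∈ Finset.range (N + 1), Real.log (y + m))
      (∑ m ∈ Finset.range (N + 1), 1 / (x + m)) x :=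
    HasDerivAt.fun_sum fun m _ =>
      ((hasDerivAt_id x).add_const (m : ℝ)).log (by positivity : (0 : ℝ) < x + m).ne'
  have h2 := (((hasDerivAt_id x).mul_const (Real.log N)).add_const
    (Real.log (N.factorial))).sub h1
  refine h2.congr_deriv ?_
  have h3 : ∑ n ∈ Finset.range N, (Real.log ((n : ℝ) + 1) - Real.log n) = Real.log N := by
    have := Finset.sum_range_sub (fun n : ℕ => Real.log n) N
    simpa using this
  simp only [digammaTerm, Finset.sum_sub_distrib _ (fun n : ℕ => 1 / (x + n + 1)), h3]
  rw [Finset.sum_range_succ']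
  push_cast
  simp only [add_assoc]
  ring

/-- Euler's limit formula for `log Γ`, differentiated through locally uniform convergence of the
derivatives. -/
theorem hasDerivAt_log_Gamma_tsum {x : ℝ} (hx : 0 < x) :
    HasDerivAt (fun y => Real.log (Real.Gamma y)) (∑' n, digammaTerm n x - 1 / x) x := by
  have hu := tendstoUniformlyOn_tsum_nat (f := digammaTerm) (s := Ioo 0 (x + 1))
    (summable_one_div_nat_add_one_sq.mul_left (4 * (x + 1 + 1)))
    (fun n y hy => norm_digammaTerm_le hy n)
  have hu' : TendstoUniformlyOn (fun N y => ∑ n ∈ Finset.range N, digammaTerm n y - 1 / y)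
      (fun y => ∑' n, digammaTerm n y - 1 / y) atTop (Ioo 0 (x + 1)) := by
    rw [Metric.tendstoUniformlyOn_iff] at hu ⊢
    simpa [dist_sub_right] using hu
  exact hasDerivAt_of_tendstoUniformlyOn isOpen_Ioo hu'
    (Eventually.of_forall fun N y hy => hasDerivAt_logGammaSeq hy.1 N)
    (fun y hy => Real.BohrMollerup.tendsto_log_gamma hy.1) ⟨hx, by linarith⟩

theorem hasDerivAt_log_Gamma {x : ℝ} (hx : 0 < x) :
    HasDerivAt (fun y => Real.log (Real.Gamma y)) (digamma x) x :=
  (hasDerivAt_log_Gamma_tsum hx).differentiableAt.hasDerivAt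

theorem hasDerivAt_digamma_hurwitzSum {x : ℝ} (hx : 0 < x) :
    HasDerivAt digamma (hurwitzSum 2 x) x := by
  have h := hasDerivAt_tsum_of_isPreconnected (t := Ioo 0 (x + 1)) (y₀ := x) (y := x)
    (g := digammaTerm) (g' := fun (n : ℕ) (y : ℝ) => 1 / (y + n + 1) ^ 2)
    summable_one_div_nat_add_one_sq isOpen_Ioo isPreconnected_Ioo ?_ ?_ ⟨hx, by linarith⟩
    (Summable.of_norm_bounded (summable_one_div_nat_add_one_sq.mul_left (4 * (x + 1 + 1)))
      fun n => norm_digammaTerm_le ⟨hx, by linarith⟩ n) ⟨hx, by linarith⟩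
  · have h2 := h.sub (hasDerivAt_inv hx.ne')
    have h3 : digamma =ᶠ[𝓝 x] fun y => ∑' n, digammaTerm n y - y⁻¹ := by
      filter_upwards [Ioi_mem_nhds hx] with y hy
      rw [digamma, (hasDerivAt_log_Gamma_tsum hy).deriv, one_div]
    refine (h2.congr_of_eventuallyEq h3).congr_deriv ?_
    rw [hurwitzSum_eq_add le_rfl hx, hurwitzSum]
    simp [add_right_comm x 1, add_comm ((x ^ 2)⁻¹)]
  · intro n y hy
    have : 0 < y + n + 1 := by have := hy.1; positivity
    have h1 := (((hasDerivAt_id y).add_const (n : ℝ)).add_const 1).inv this.ne'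
    have e : digammaTerm n = fun y : ℝ => Real.log (n + 1) - Real.log n - (y + n + 1)⁻¹ := by
      ext; rw [digammaTerm, one_div]
    rw [e]
    refine (h1.const_sub _).congr_deriv ?_
    simp [div_eq_mul_inv]
  · intro n y hy
    have := hy.1
    rw [Real.norm_of_nonneg (by positivity)]
    gcongr
    linarith

theorem trigamma_eq_hurwitzSum {x : ℝ} (hx : 0 < x) : trigamma x = hurwitzSum 2 x :=
  (hasDerivAt_digamma_hurwitzSum hx).deriv

theorem hasDerivAt_digamma {x : ℝ} (hx : 0 < x) : HasDerivAt digamma (trigamma x) x :=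
  (hasDerivAt_digamma_hurwitzSum hx).differentiableAt.hasDerivAt

/-! ### The Dirichlet integral -/

theorem lintegral_beta {a b c : ℝ} (ha : 0 < a) (hb : 0 < b) (hc : 0 < c) :
    ∫⁻ t in Ioo 0 c, ENNReal.ofReal (t ^ (a - 1) * (c - t) ^ (b - 1)) =
      ENNReal.ofReal (Real.Gamma a * Real.Gamma b / Real.Gamma (a + b) * c ^ (a + b - 1)) := by
  have hB := ProbabilityTheory.beta_pos ha hb
  have h1 : ∫⁻ t in Ioo (0 : ℝ) 1, ENNReal.ofReal (t ^ (a - 1) * (1 - t) ^ (b - 1)) =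
      ENNReal.ofReal (ProbabilityTheory.beta a b) := by
    have h := ProbabilityTheory.lintegral_betaPDF_eq_one ha hb
    rw [ProbabilityTheory.lintegral_betaPDF] at h
    simp only [mul_assoc, ENNReal.ofReal_mul (one_div_pos.2 hB).le] at h
    rw [lintegral_const_mul _ (by fun_prop)] at h
    calc _ = ENNReal.ofReal (ProbabilityTheory.beta a b) *
          (ENNReal.ofReal (1 / ProbabilityTheory.beta a b) *
            ∫⁻ t in Ioo (0 : ℝ) 1, ENNReal.ofReal (t ^ (a - 1) * (1 - t) ^ (b - 1))) := by
          rw [← mul_assoc, ← ENNReal.ofReal_mul hB.le, mul_one_div_cancel hB.ne',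
            ENNReal.ofReal_one, one_mul]
      _ = _ := by rw [h, mul_one]
  have himg : (fun s => c * s) '' Ioo (0 : ℝ) 1 = Ioo 0 c := by
    rw [Set.image_mul_left_Ioo hc]; simp
  rw [← himg, lintegral_image_eq_lintegral_abs_deriv_mul measurableSet_Ioo (f' := fun _ => c)
    (fun s _ => by simpa using ((hasDerivAt_id s).const_mul c).hasDerivWithinAt)
    (fun s _ t _ h => mul_left_cancel₀ hc.ne' h)]
  have h2 : ∀ s ∈ Ioo (0 : ℝ) 1, ENNReal.ofReal |c| *
      ENNReal.ofReal ((c * s) ^ (a - 1) * (c - c * s) ^ (b - 1)) =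
      ENNReal.ofReal (c ^ (a + b - 1)) * ENNReal.ofReal (s ^ (a - 1) * (1 - s) ^ (b - 1)) := by
    intro s hs
    rw [← ENNReal.ofReal_mul (abs_nonneg c), ← ENNReal.ofReal_mul (by positivity),
      abs_of_pos hc, show c - c * s = c * (1 - s) by ring, Real.mul_rpow hc.le hs.1.le,
      Real.mul_rpow hc.le (sub_pos.2 hs.2).le,
      show a + b - 1 = 1 + (a - 1) + (b - 1) by ring, Real.rpow_add hc, Real.rpow_add hc,
      Real.rpow_one]
    congr 1
    ring
  rw [setLIntegral_congr_fun measurableSet_Ioo h2, lintegral_const_mul _ (by fun_prop), h1,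
    ← ENNReal.ofReal_mul (by positivity), mul_comm, ProbabilityTheory.beta]

/-- The open simplex `{y ∈ ℝᵐ | yᵢ > 0, ∑ᵢ yᵢ < c}`. -/
def openSimplex (m : ℕ) (c : ℝ) : Set (Fin m → ℝ) := {y | (∀ i, 0 < y i) ∧ ∑ i, y i < c}

theorem measurableSet_openSimplex (m : ℕ) (c : ℝ) : MeasurableSet (openSimplex m c) := by
  have : openSimplex m c = orthant m ∩ {y | ∑ i, y i < c} := rfl
  rw [this]
  exact (isOpen_orthant m).measurableSet.inter
    (measurableSet_lt (by fun_prop) measurable_const)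

/-- Fixing the first coordinate `t` leaves a simplex of size `c - t`, hence the general `c` in the
induction; the remaining integral over `t` is a beta integral. -/
theorem lintegral_openSimplex {m : ℕ} {a : Fin m → ℝ} (ha : ∀ i, 0 < a i) {b c : ℝ} (hb : 0 < b)
    (hc : 0 < c) :
    ∫⁻ y in openSimplex m c, ENNReal.ofReal ((∏ i, y i ^ (a i - 1)) * (c - ∑ i, y i) ^ (b - 1)) =
      ENNReal.ofReal ((∏ i, Real.Gamma (a i)) * Real.Gamma b / Real.Gamma (∑ i, a i + b) *
        c ^ (∑ i, a i + b - 1)) := by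
  induction m generalizing b c with
  | zero =>
    have hG := (Real.Gamma_pos_of_pos hb).ne'
    have huniv : openSimplex 0 c = univ := by ext y; simp [openSimplex, hc]
    rw [huniv]
    simp [lintegral_unique, hG, Measure.volume_pi_eq_dirac 0]
  | succ m ih =>
    have hmp := (volume_preserving_piFinSuccAbove (fun _ : Fin (m + 1) => ℝ) 0).symm
    have hβ : 0 < ∑ i : Fin m, a i.succ + b :=
      add_pos_of_nonneg_of_pos (Finset.sum_nonneg fun i _ => (ha _).le) hb
    have hmem : ∀ (t : ℝ) (y : Fin m → ℝ),
        (MeasurableEquiv.piFinSuccAbove (fun _ => ℝ) 0).symm (t, y) ∈ openSimplex (m + 1) c ↔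
          t ∈ Ioo 0 c ∧ y ∈ openSimplex m (c - t) := by
      intro t y
      simp only [openSimplex, mem_ofPred_eq, MeasurableEquiv.piFinSuccAbove_symm_apply,
        Fin.insertNthEquiv_zero, Fin.consEquiv_apply, Fin.forall_fin_succ, Fin.cons_zero, Fin.cons_succ,
        Fin.sum_univ_succ, mem_Ioo]
      constructor
      · rintro ⟨⟨h1, h2⟩, h3⟩
        have := Finset.sum_nonneg fun i (_ : i ∈ Finset.univ) => (h2 i).le
        exact ⟨⟨h1, by linarith⟩, h2, by linarith⟩
      · rintro ⟨⟨h1, h2⟩, h3, h4⟩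
        exact ⟨⟨h1, h3⟩, by linarith⟩
    rw [← lintegral_indicator (measurableSet_openSimplex _ _), ← hmp.lintegral_comp_emb
      (MeasurableEquiv.measurableEmbedding _), Measure.volume_eq_prod, lintegral_prod]
    · have hinner : ∀ t : ℝ, ∫⁻ y, (openSimplex (m + 1) c).indicator
          (fun y => ENNReal.ofReal ((∏ i, y i ^ (a i - 1)) * (c - ∑ i, y i) ^ (b - 1)))
          ((MeasurableEquiv.piFinSuccAbove (fun _ => ℝ) 0).symm (t, y)) =
          (Ioo 0 c).indicator (fun t => ENNReal.ofReal ((∏ i : Fin m, Real.Gamma (a i.succ)) *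
            Real.Gamma b / Real.Gamma (∑ i : Fin m, a i.succ + b)) *
            ENNReal.ofReal (t ^ (a 0 - 1) * (c - t) ^ (∑ i : Fin m, a i.succ + b - 1))) t := by
        intro t
        by_cases ht : t ∈ Ioo 0 c
        · rw [indicator_of_mem ht]
          have e : ∀ y : Fin m → ℝ, (openSimplex (m + 1) c).indicator
              (fun y => ENNReal.ofReal ((∏ i, y i ^ (a i - 1)) * (c - ∑ i, y i) ^ (b - 1)))
              ((MeasurableEquiv.piFinSuccAbove (fun _ => ℝ) 0).symm (t, y)) =
              ENNReal.ofReal (t ^ (a 0 - 1)) * (openSimplex m (c - t)).indicator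
              (fun y => ENNReal.ofReal ((∏ i, y i ^ (a i.succ - 1)) *
                (c - t - ∑ i, y i) ^ (b - 1))) y := by
            intro y
            by_cases hy : y ∈ openSimplex m (c - t)
            · rw [indicator_of_mem hy, indicator_of_mem ((hmem t y).2 ⟨ht, hy⟩),
                ← ENNReal.ofReal_mul (Real.rpow_nonneg ht.1.le _)]
              simp only [MeasurableEquiv.piFinSuccAbove_symm_apply, Fin.insertNthEquiv_zero,
                Fin.consEquiv_apply, Fin.prod_univ_succ, Fin.sum_univ_succ, Fin.cons_zero, Fin.cons_succ]
              rw [sub_sub, mul_assoc]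
            · rw [indicator_of_notMem hy, indicator_of_notMem
                (fun h => hy ((hmem t y).1 h).2), mul_zero]
          have hct : 0 < c - t := sub_pos.2 ht.2
          simp only [e]
          rw [lintegral_const_mul' _ _ ENNReal.ofReal_ne_top,
            lintegral_indicator (measurableSet_openSimplex _ _),
            ih (fun i => ha i.succ) hb hct, ← ENNReal.ofReal_mul (Real.rpow_nonneg ht.1.le _),
            ← ENNReal.ofReal_mul' (mul_nonneg (Real.rpow_nonneg ht.1.le _)
              (Real.rpow_nonneg hct.le _))]
          congr 1
          ring
        · rw [indicator_of_notMem ht]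
          have e : ∀ y : Fin m → ℝ, (openSimplex (m + 1) c).indicator
              (fun y => ENNReal.ofReal ((∏ i, y i ^ (a i - 1)) * (c - ∑ i, y i) ^ (b - 1)))
              ((MeasurableEquiv.piFinSuccAbove (fun _ => ℝ) 0).symm (t, y)) = 0 := fun y =>
            indicator_of_notMem (fun h => ht ((hmem t y).1 h).1) _
          simp only [e, lintegral_zero]
      simp only [hinner]
      rw [lintegral_indicator measurableSet_Ioo, lintegral_const_mul' _ _ ENNReal.ofReal_ne_top,
        lintegral_beta (ha 0) hβ hc, ← ENNReal.ofReal_mul' ?_]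
      · have hG := (Real.Gamma_pos_of_pos hβ).ne'
        rw [Fin.prod_univ_succ, Fin.sum_univ_succ, add_assoc]
        congr 1
        field_simp
      · have h1 := Real.Gamma_pos_of_pos (ha 0)
        have h2 := Real.Gamma_pos_of_pos hβ
        have h3 := Real.Gamma_pos_of_pos (add_pos (ha 0) hβ)
        positivity
    · refine ((Measurable.indicator ?_ (measurableSet_openSimplex _ _)).comp
        (MeasurableEquiv.measurable _)).aemeasurable
      fun_prop

theorem volume_linearMap_fiber {m : ℕ} (ℓ : (Fin m → ℝ) →ₗ[ℝ] ℝ) (c : ℝ) (h : ∃ y, ℓ y ≠ c) :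
    volume {y | ℓ y = c} = 0 := by
  obtain ⟨y, hy⟩ := h
  have := Measure.addHaar_affineSubspace (volume : Measure (Fin m → ℝ))
    ((AffineSubspace.mk' c ⊥).comap ℓ.toAffineMap) (fun htop => hy ?_)
  · convert this using 2
    ext z
    simp [AffineSubspace.mem_mk', sub_eq_zero]
  · have : y ∈ (AffineSubspace.mk' c ⊥).comap ℓ.toAffineMap := by rw [htop]; trivial
    simpa [AffineSubspace.mem_mk', sub_eq_zero] using this

theorem closedSimplex_ae_eq_openSimplex (m : ℕ) :
    ({y | (∀ i, 0 ≤ y i) ∧ ∑ i, y i ≤ 1} : Set (Fin m → ℝ)) =ᵐ[volume] openSimplex m 1 := by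
  have h1 : ∀ᵐ y : Fin m → ℝ, ∑ i, y i ≠ 1 := by
    have := volume_linearMap_fiber (∑ i, LinearMap.proj i : (Fin m → ℝ) →ₗ[ℝ] ℝ) 1 ⟨0, by simp⟩
    rw [ae_iff]
    simpa using this
  have h2 : ∀ᵐ y : Fin m → ℝ, ∀ i, y i ≠ 0 := by
    rw [ae_all_iff]
    intro i
    have := volume_linearMap_fiber (LinearMap.proj i : (Fin m → ℝ) →ₗ[ℝ] ℝ) 0
      ⟨Pi.single i 1, by simp⟩
    rw [ae_iff]
    simpa using this
  filter_upwards [h1, h2] with y hy1 hy2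
  refine propext ⟨fun h => ⟨fun i => (h.1 i).lt_of_ne (hy2 i).symm, h.2.lt_of_ne hy1⟩,
    fun h => ⟨fun i => (h.1 i).le, h.2.le⟩⟩

theorem measurable_snoc (m : ℕ) : Measurable fun y : Fin m → ℝ =>
    (Fin.snoc (α := fun _ => ℝ) y (1 - ∑ i, y i) : Fin (m + 1) → ℝ) := by
  refine measurable_pi_iff.2 fun i => ?_
  refine Fin.lastCases ?_ (fun i => ?_) i
  · simp only [Fin.snoc_last]; fun_prop
  · simp only [Fin.snoc_castSucc]; fun_prop

theorem measurable_dirichletDensity {n : ℕ} (x : Fin n → ℝ) : Measurable (dirichletDensity x) := by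
  unfold dirichletDensity
  fun_prop

theorem simplexLebesgue_succ (m : ℕ) : simplexLebesgue (m + 1) =
    ((volume : Measure (Fin m → ℝ)).restrict (openSimplex m 1)).map
      fun y => Fin.snoc (α := fun _ => ℝ) y (1 - ∑ i, y i) := by
  rw [simplexLebesgue, Measure.restrict_congr_set (closedSimplex_ae_eq_openSimplex m)]

theorem isProbabilityMeasure_dirichletMeasure {n : ℕ} (hn : 0 < n) {x : Fin n → ℝ}
    (hx : x ∈ orthant n) : IsProbabilityMeasure (dirichletMeasure x) := by
  obtain ⟨m, rfl⟩ : ∃ m, n = m + 1 := ⟨n - 1, by omega⟩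
  refine ⟨?_⟩
  have hs := Real.Gamma_pos_of_pos (sum_pos_of_mem_orthant hn hx)
  have hprod : 0 < ∏ i, Real.Gamma (x i) := Finset.prod_pos fun i _ => Real.Gamma_pos_of_pos (hx i)
  rw [dirichletMeasure, withDensity_apply _ MeasurableSet.univ, Measure.restrict_univ,
    simplexLebesgue_succ, lintegral_map (measurable_dirichletDensity x).ennreal_ofReal
      (measurable_snoc m)]
  simp only [dirichletDensity, Fin.prod_univ_castSucc (f := fun i => _ ^ (x i - 1)),
    Fin.snoc_castSucc, Fin.snoc_last, ENNReal.ofReal_mul (div_pos hs hprod).le]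
  rw [lintegral_const_mul' _ _ ENNReal.ofReal_ne_top,
    lintegral_openSimplex (fun i => hx i.castSucc) (hx (Fin.last m)) one_pos,
    ← ENNReal.ofReal_mul (div_pos hs hprod).le, Real.one_rpow, mul_one,
    ← Fin.prod_univ_castSucc (f := fun i => Real.Gamma (x i)), ← Fin.sum_univ_castSucc,
    div_mul_div_cancel₀ hprod.ne', div_self hs.ne', ENNReal.ofReal_one]

theorem ae_dirichletMeasure_pos {n : ℕ} (x : Fin n → ℝ) :
    ∀ᵐ q ∂dirichletMeasure x, ∀ i, 0 < q i := by
  refine (withDensity_absolutelyContinuous _ _).ae_le ?_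
  rcases n with _ | m
  · simp [simplexLebesgue]
  · rw [simplexLebesgue_succ]
    refine (ae_map_iff (measurable_snoc m).aemeasurable
      (isOpen_orthant (m + 1)).measurableSet).2 ?_
    filter_upwards [ae_restrict_mem (measurableSet_openSimplex m 1)] with y hy
    intro i
    refine Fin.lastCases ?_ (fun i => ?_) i
    · simpa using hy.2
    · simpa using hy.1 i

/-! ### The Fisher–Rao metric -/

theorem log_dirichletDensity {n : ℕ} (hn : 0 < n) {q : Fin n → ℝ} (hq : ∀ i, 0 < q i)
    {z : Fin n → ℝ} (hz : z ∈ orthant n) :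
    Real.log (dirichletDensity z q) =
      Real.log (Real.Gamma (∑ i, z i)) - ∑ i, Real.log (Real.Gamma (z i)) +
        ∑ i, (z i - 1) * Real.log (q i) := by
  have hs := (Real.Gamma_pos_of_pos (sum_pos_of_mem_orthant hn hz)).ne'
  have hG : ∀ i, Real.Gamma (z i) ≠ 0 := fun i => (Real.Gamma_pos_of_pos (hz i)).ne'
  have hpow : ∀ i, q i ^ (z i - 1) ≠ 0 := fun i => (Real.rpow_pos_of_pos (hq i) _).ne'
  rw [dirichletDensity, Real.log_mul (div_ne_zero hs (Finset.prod_ne_zero_iff.2 fun i _ => hG i))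
    (Finset.prod_ne_zero_iff.2 fun i _ => hpow i), Real.log_div hs
    (Finset.prod_ne_zero_iff.2 fun i _ => hG i), Real.log_prod fun i _ => hG i,
    Real.log_prod fun i _ => hpow i]
  congr 1
  exact Finset.sum_congr rfl fun i _ => Real.log_rpow (hq i) _

theorem partialDeriv_log_dirichletDensity {n : ℕ} (hn : 0 < n) {q : Fin n → ℝ} (hq : ∀ i, 0 < q i)
    {z : Fin n → ℝ} (hz : z ∈ orthant n) (j : Fin n) :
    partialDeriv j (fun z => Real.log (dirichletDensity z q)) z =
      digamma (∑ i, z i) - digamma (z j) + Real.log (q j) := by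
  have h : (fun z => Real.log (dirichletDensity z q)) =ᶠ[𝓝 z] fun z =>
      Real.log (Real.Gamma (∑ i, z i)) - ∑ i, Real.log (Real.Gamma (z i)) +
        ∑ i, (z i - 1) * Real.log (q i) := by
    filter_upwards [(isOpen_orthant n).mem_nhds hz] with w hw using log_dirichletDensity hn hq hw
  rw [partialDeriv_congr h]
  have h1 := hasFDerivAt_comp_sum (hasDerivAt_log_Gamma (sum_pos_of_mem_orthant hn hz))
  have h2 := HasFDerivAt.fun_sum fun i (_ : i ∈ Finset.univ) =>
    hasFDerivAt_comp_coord i (hasDerivAt_log_Gamma (hz i))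
  have h3 := HasFDerivAt.fun_sum fun i (_ : i ∈ Finset.univ) =>
    hasFDerivAt_comp_coord (x := z) i
      (((hasDerivAt_id (z i)).sub_const 1).mul_const (Real.log (q i)))
  refine (partialDeriv_of_hasFDerivAt ((h1.sub h2).add h3) j).trans ?_
  rw [add_apply, sub_apply, smul_apply, sum_proj_single, sum_apply, sum_apply]
  simp [Pi.single_apply]

/-- In this exponential family `q` enters the log-density only through terms affine in the
parameter, so the Hessian is free of `q`. -/
theorem partialDeriv_partialDeriv_log_dirichletDensity {n : ℕ} (hn : 0 < n) {q : Fin n → ℝ}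
    (hq : ∀ i, 0 < q i) {z : Fin n → ℝ} (hz : z ∈ orthant n) (i j : Fin n) :
    partialDeriv i (partialDeriv j fun z => Real.log (dirichletDensity z q)) z =
      trigamma (∑ l, z l) - if i = j then trigamma (z i) else 0 := by
  have h : partialDeriv j (fun z => Real.log (dirichletDensity z q)) =ᶠ[𝓝 z] fun z =>
      digamma (∑ i, z i) - digamma (z j) + Real.log (q j) := by
    filter_upwards [(isOpen_orthant n).mem_nhds hz] with w hw using
      partialDeriv_log_dirichletDensity hn hq hw j
  rw [partialDeriv_congr h]
  have h1 := hasFDerivAt_comp_sum (hasDerivAt_digamma (sum_pos_of_mem_orthant hn hz))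
  have h2 := hasFDerivAt_comp_coord j (hasDerivAt_digamma (hz j))
  refine (partialDeriv_of_hasFDerivAt ((h1.sub h2).add_const (Real.log (q j))) i).trans ?_
  rw [sub_apply, smul_apply, smul_apply, sum_proj_single]
  by_cases hij : i = j
  · subst hij; simp
  · simp [hij, Ne.symm hij]

theorem dirichletFisherRao_eq_profileMetric {n : ℕ} (hn : 0 < n) {x : Fin n → ℝ}
    (hx : x ∈ orthant n) :
    dirichletFisherRao x = profileMetric (fun t => 1 / trigamma t) x := by
  have := isProbabilityMeasure_dirichletMeasure hn hx
  ext i j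
  simp only [dirichletFisherRao, profileMetric, Matrix.of_apply, one_div_one_div]
  rw [integral_congr_ae (g := fun _ => trigamma (∑ l, x l) - if i = j then trigamma (x i) else 0)
    ((ae_dirichletMeasure_pos x).mono fun q hq =>
      partialDeriv_partialDeriv_log_dirichletDensity hn hq hx i j)]
  simp

theorem dirichletFisherRao_eqOn {n : ℕ} (hn : 0 < n) :
    EqOn dirichletFisherRao (profileMetric fun t => 1 / hurwitzSum 2 t) (orthant n) := by
  intro x hx
  rw [dirichletFisherRao_eq_profileMetric hn hx]
  simp only [profileMetric, trigamma_eq_hurwitzSum (sum_pos_of_mem_orthant hn hx),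
    trigamma_eq_hurwitzSum (hx _)]

theorem IsRiemannianMetricOn.congr {n : ℕ} {g h : (Fin n → ℝ) → Matrix (Fin n) (Fin n) ℝ}
    {U : Set (Fin n → ℝ)} (hg : IsRiemannianMetricOn g U) (hgh : EqOn h g U) :
    IsRiemannianMetricOn h U where
  isOpen := hg.isOpen
  contDiffOn i j := (hg.contDiffOn i j).congr fun x hx => by rw [hgh hx]
  posDef x hx := by rw [hgh hx]; exact hg.posDef x hx

end DirichletGeometry

theorem theorem3p6 (n : ℕ) (hn : 2 ≤ n) :
    (∀ f : ℝ → ℝ, DirichletGeometry.IsAdmissibleProfile f →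
      DirichletGeometry.IsRiemannianMetricOn
        (DirichletGeometry.profileMetric f) (DirichletGeometry.orthant n) ∧
      DirichletGeometry.HasNegativeSectionalCurvatureOn
        (DirichletGeometry.profileMetric f) (DirichletGeometry.orthant n)) ∧
    ((∀ x ∈ DirichletGeometry.orthant n,
        DirichletGeometry.dirichletFisherRao x =
          DirichletGeometry.profileMetric (fun t => 1 / DirichletGeometry.trigamma t) x) ∧
      DirichletGeometry.IsRiemannianMetricOn
        DirichletGeometry.dirichletFisherRao (DirichletGeometry.orthant n) ∧
      DirichletGeometry.HasNegativeSectionalCurvatureOn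
        DirichletGeometry.dirichletFisherRao (DirichletGeometry.orthant n)) := by
  have hn0 : 0 < n := by omega
  refine ⟨fun f hf => ⟨hf.isStarShapedProfile.isRiemannianMetricOn hn,
      hf.isStarShapedProfile.hasNegativeSectionalCurvatureOn hn fun _ _ => rfl⟩,
    fun x hx => DirichletGeometry.dirichletFisherRao_eq_profileMetric hn0 hx, ?_, ?_⟩
  -- The Dirichlet profile enters through star-shapedness directly, bypassing the convexity
  -- conditions of `IsAdmissibleProfile`.
  · exact (DirichletGeometry.isStarShapedProfile_one_div_hurwitzSum.isRiemannianMetricOn hn).congr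
      (DirichletGeometry.dirichletFisherRao_eqOn hn0)
  · exact DirichletGeometry.isStarShapedProfile_one_div_hurwitzSum.hasNegativeSectionalCurvatureOn
      hn (DirichletGeometry.dirichletFisherRao_eqOn hn0)
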